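/- Let $d\in\{2,3\}$ and let $\Omega\subset\mathbb R^d$ be a bounded polygonal/polyhedral domain (open, connected) with Lipschitz boundary. Let $H^1_0(\Omega,\mathbb C)^d$ carry the norm $\|v\|_{1,\Omega}=(\|v\|_{0,\Omega}^2+\|\nabla v\|_{0,\Omega}^2)^{1/2}$, let $L^2_0(\Omega,\mathbb C)$ be the space of $L^2$ functions with mean value zero, and let $\mathcal X=H^1_0(\Omega,\mathbb C)^d\times L^2_0(\Omega,\mathbb C)$ with $\|(v,q)\|=(\|v\|_{1,\Omega}^2+\|q\|_{0,\Omega}^2)^{1/2}$. For a viscosity $\nu>0$ and a real divergence-free field $\beta\in W^{1,\infty}(\Omega,\mathbb R)^d$, with $\|\beta\|_\infty=\operatorname{ess\,sup}_\Omega|\beta|$, put $$a(u,v)=\int_\Omega \nu\,\nabla u:\overline{\nabla v}+\int_\Omega(\beta\cdot\nabla)u\cdot\overline v,\qquad b(v,q)=-\int_\Omega q\,\overline{\operatorname{div}v},$$ $$A((u,p);(v,q))=a(u,v)+b(v,p)-\overline{b(u,q)},$$ and, with $\widehat a(v,w)=\int_\Omega\nu\,\nabla v:\overline{\nabla w}+\int_\Omega\nabla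 v:\overline{(w\otimes\beta)}$ and $(w\otimes\beta)_{ij}=w_i\beta_j$, $$\widehat A((v,q);(w,r))=\widehat a(v,w)-\overline{b(v,r)}+b(w,q).$$ Call $C_p>0$ a Poincaré constant if $C_p\|v\|_{1,\Omega}^2\le\|\nabla v\|_{0,\Omega}^2$ for all $v\in H^1_0(\Omega,\mathbb C)^d$, and call $C>0$ a divergence constant if every $q\in L^2_0(\Omega,\mathbb C)$ equals $-\operatorname{div}v$ for some $v\in H^1_0(\Omega,\mathbb C)^d$ with $\|v\|_{1,\Omega}\le C\|q\|_{0,\Omega}$. Then a Poincaré constant and a divergence constant of $\Omega$ exist, and for all such $\nu,\beta$ there is a number $\gamma=\gamma(\nu,\beta)>0$ such that the following holds. 1. For $F=A$ and for $F=\widehat A$ (with the same $\gamma$), $$\inf_{0\ne(w,r)\in\mathcal X}\ \sup_{0\ne(v,q)\in\mathcal X}\frac{|F((v,q);(w,r))|}{\|(v,q)\|\,\|(w,r)\|}=\gamma=\inf_{0\ne(v,q)\in\mathcal X}\ \sup_{0\ne(w,r)\in\mathcal X}\frac{|F((v,q);(w,r))|}{\|(v,q)\|\,\|(w,r)\|},$$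 and for every $(v,q)\in\mathcal X$ there is $(w,r)\in\mathcal X$ such that $\|w\|_{1,\Omega}+\|r\|_{0,\Omega}\le 2/\gamma$, $F((v,q);(w,r))$ is real, and $\|v\|_{1,\Omega}+\|q\|_{0,\Omega}\le F((v,q);(w,r))$. 2. For every Poincaré constant $C_p$ and every divergence constant $C$ of $\Omega$, $$\gamma\ \ge\ \frac{1}{\sqrt2\,\Bigl\{\nu^{-2}C_p^{-2}+2C^2\bigl[1+2C^2C_p^{-2}\bigl(\nu^{1/2}+\nu^{-1/2}\|\beta\|_\infty\bigr)^4\bigr]\Bigr\}^{1/2}} .$$ 3. For every Poincaré constant $C_p$ and every $\nu^+>0$ there is $C'>0$, depending only on $\Omega$, $C_p$ and $\nu^+$, such that for all $\nu\in(0,\nu^+)$ and all such $\beta$, $$\gamma\ \ge\ \frac{1}{2\,\Bigl\{\nu^{-2}C_p^{-2}+2C'\bigl[1+C_p^{2}\bigl(\nu+\nu^{-1}\|\beta\|_\infty\bigr)^4\bigr]\Bigr\}^{1/2}} .$$ 4. The constant is uniform in $\nu$: for all $0<\nu^-<\nu^+$ and all $M$ there is $\gamma_0>0$, depending only on $\Omega,\nu^-,\nu^+,M$,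 such that $\gamma(\nu,\beta)\ge\gamma_0$ whenever $\nu^-<\nu<\nu^+$ and $\|\beta\|_\infty\le M$. -/

import Mathlib

open MeasureTheory
open scoped ENNReal ContDiff ComplexConjugate

noncomputable section

namespace Oseen

/-- The Euclidean space `ℝᵈ`. -/
abbrev Pt (d : ℕ) := EuclideanSpace ℝ (Fin d)

/-! ### The domain -/

/-- `Ω` is a bounded polygonal or polyhedral domain with Lipschitz boundary: `Ω` is open, connected
(in particular nonempty) and bounded; its boundary is contained in a finite union of hyperplanes
`{x : ⟪n, x⟫ = c}`; and around each boundary point `Ω` is, in a suitable direction `e`, the strict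
epigraph of a Lipschitz function of the component of the point orthogonal to `e`. -/
structure IsLipschitzPolyhedralDomain {d : ℕ} (Ω : Set (Pt d)) : Prop where
  isOpen : IsOpen Ω
  isConnected : IsConnected Ω
  isBounded : Bornology.IsBounded Ω
  polyhedral : ∃ S : Finset (Pt d × ℝ), (∀ s ∈ S, s.1 ≠ 0) ∧
    ∀ x ∈ frontier Ω, ∃ s ∈ S, inner ℝ s.1 x = s.2
  lipschitz : ∀ x ∈ frontier Ω, ∃ (e : Pt d) (φ : Pt d → ℝ) (K : NNReal),
    ‖e‖ = 1 ∧ LipschitzWith K φ ∧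
      ∀ᶠ y in nhds x, (y ∈ Ω ↔ φ (y - (inner ℝ e y : ℝ) • e) < inner ℝ e y)

/-! ### Test functions and weak derivatives -/

/-- The classical partial derivative `∂ⱼ f (x)`. -/
def pderiv {d : ℕ} {F : Type*} [NormedAddCommGroup F] [NormedSpace ℝ F]
    (j : Fin d) (f : Pt d → F) (x : Pt d) : F :=
  fderiv ℝ f x (EuclideanSpace.single j 1)

/-- `φ ∈ C_c^∞(Ω, F)`. -/
structure IsTestFunction {d : ℕ} {F : Type*} [NormedAddCommGroup F] [NormedSpace ℝ F]
    (Ω : Set (Pt d)) (φ : Pt d → F) : Prop where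
  smooth : ContDiff ℝ ∞ φ
  compact : HasCompactSupport φ
  support : tsupport φ ⊆ Ω

/-- `g` is the weak partial derivative `∂ⱼ f` in `Ω`. It is used for bounded `f` and `g` on a
bounded set only, so that both integrals exist. -/
def HasWeakPartial {d : ℕ} (Ω : Set (Pt d)) (j : Fin d) (f g : Pt d → ℝ) : Prop :=
  ∀ φ : Pt d → ℝ, IsTestFunction Ω φ →
    ∫ x in Ω, f x * pderiv j φ x = - ∫ x in Ω, g x * φ x

/-- The convective field: real, in `W^{1,∞}(Ω)ᵈ`, and divergence free. -/
def IsConvectiveField {d : ℕ} (Ω : Set (Pt d)) (β : Pt d → Pt d) : Prop :=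
  MemLp β ∞ (volume.restrict Ω) ∧
  ∃ D : Fin d → Fin d → Pt d → ℝ,
    (∀ i j, MemLp (D i j) ∞ (volume.restrict Ω) ∧
      HasWeakPartial Ω j (fun x => β x i) (D i j)) ∧
    ∀ᵐ x ∂(volume.restrict Ω), ∑ i, D i i x = 0

/-- `‖β‖_{∞,Ω}`, the essential supremum over `Ω` of the Euclidean length of `β`. -/
def supNorm {d : ℕ} (Ω : Set (Pt d)) (β : Pt d → Pt d) : ℝ :=
  (eLpNorm β ∞ (volume.restrict Ω)).toReal

/-! ### The spaces -/

/-- `L²(Ω, ℂ)ᵈ`. -/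
abbrev L2Vec {d : ℕ} (Ω : Set (Pt d)) :=
  Lp (EuclideanSpace ℂ (Fin d)) 2 (volume.restrict Ω)

/-- `L²(Ω, ℂ)^{d × d}`, with the Frobenius norm on matrices. -/
abbrev L2Mat {d : ℕ} (Ω : Set (Pt d)) :=
  Lp (EuclideanSpace ℂ (Fin d × Fin d)) 2 (volume.restrict Ω)

/-- The Hilbert space of pairs `(v, G)`, with the norm `(‖v‖² + ‖G‖²)^{1/2}`. The space
`H¹(Ω, ℂ)ᵈ` is the closed subspace of the pairs `(v, ∇v)`, and the norm of `(v, ∇v)` is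
`‖v‖_{1,Ω}`. -/
abbrev FieldPair {d : ℕ} (Ω : Set (Pt d)) := WithLp 2 (L2Vec Ω × L2Mat Ω)

/-- The pairs `(φ, ∇φ)` with `φ ∈ C_c^∞(Ω, ℂ)ᵈ`; the entry `(i, j)` of `∇φ` is `∂ⱼ φᵢ`. -/
def testFields {d : ℕ} (Ω : Set (Pt d)) : Submodule ℂ (FieldPair Ω) where
  carrier := {z | ∃ φ : Fin d → Pt d → ℂ, (∀ i, IsTestFunction Ω (φ i)) ∧
    (∀ᵐ x ∂(volume.restrict Ω), ∀ i, z.fst x i = φ i x) ∧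
    (∀ᵐ x ∂(volume.restrict Ω), ∀ i j, z.snd x (i, j) = pderiv j (φ i) x)}
  add_mem' := by
    rintro z w ⟨φ, hφ, hz, hz'⟩ ⟨ψ, hψ, hw, hw'⟩
    refine ⟨fun i x => φ i x + ψ i x, fun i => ⟨(hφ i).smooth.add (hψ i).smooth,
      (hφ i).compact.add (hψ i).compact, (tsupport_add (φ i) (ψ i)).trans
        (Set.union_subset (hφ i).support (hψ i).support)⟩, ?_, ?_⟩
    · filter_upwards [hz, hw, Lp.coeFn_add z.fst w.fst] with x h1 h2 h3 i
      rw [WithLp.add_fst, h3]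
      simp [h1 i, h2 i]
    · filter_upwards [hz', hw', Lp.coeFn_add z.snd w.snd] with x h1 h2 h3 i j
      rw [WithLp.add_snd, h3]
      have e1 := ((hφ i).smooth.differentiable (by simp)) x
      have e2 := ((hψ i).smooth.differentiable (by simp)) x
      simp [h1 i j, h2 i j, pderiv, fderiv_fun_add e1 e2]
  zero_mem' := by
    refine ⟨fun _ _ => 0, fun i => ⟨contDiff_const, HasCompactSupport.zero, by simp [tsupport]⟩,
      ?_, ?_⟩
    · filter_upwards [Lp.coeFn_zero (EuclideanSpace ℂ (Fin d)) 2 (volume.restrict Ω)] with x h i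
      rw [WithLp.zero_fst, h]
      simp
    · filter_upwards [Lp.coeFn_zero (EuclideanSpace ℂ (Fin d × Fin d)) 2
        (volume.restrict Ω)] with x h i j
      rw [WithLp.zero_snd, h]
      simp [pderiv]
  smul_mem' := by
    rintro c z ⟨φ, hφ, hz, hz'⟩
    refine ⟨fun i x => c * φ i x, fun i => ⟨contDiff_const.mul (hφ i).smooth,
      (hφ i).compact.mul_left, (tsupport_mul_subset_right).trans (hφ i).support⟩, ?_, ?_⟩
    · filter_upwards [hz, Lp.coeFn_smul c z.fst] with x h1 h3 i
      rw [WithLp.smul_fst, h3]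
      simp [h1 i]
    · filter_upwards [hz', Lp.coeFn_smul c z.snd] with x h1 h3 i j
      rw [WithLp.smul_snd, h3]
      have e1 := ((hφ i).smooth.differentiable (by simp)) x
      simp [h1 i j, pderiv, fderiv_const_mul e1 c]

/-- `H¹₀(Ω, ℂ)ᵈ`, the closure of `C_c^∞(Ω, ℂ)ᵈ` in the `H¹` norm. An element is the pair
`(v, ∇v)`; its norm is `‖v‖_{1,Ω} = (‖v‖² + ‖∇v‖²)^{1/2}`. -/
def H10 {d : ℕ} (Ω : Set (Pt d)) : Submodule ℂ (FieldPair Ω) :=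
  (testFields Ω).topologicalClosure

/-- `L²₀(Ω, ℂ)`, the square integrable functions of mean value zero (on a bounded set the
integrability is automatic). -/
def L20 {d : ℕ} (Ω : Set (Pt d)) : Submodule ℂ (Lp ℂ 2 (volume.restrict Ω)) where
  carrier := {q | Integrable q (volume.restrict Ω) ∧ ∫ x in Ω, q x = 0}
  add_mem' := by
    rintro p q ⟨hp, hp'⟩ ⟨hq, hq'⟩
    refine ⟨(hp.add hq).congr (Lp.coeFn_add p q).symm, ?_⟩
    rw [integral_congr_ae (Lp.coeFn_add p q)]
    simp only [Pi.add_apply]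
    rw [integral_add hp hq, hp', hq', add_zero]
  zero_mem' := by
    refine ⟨(integrable_zero _ _ _).congr (Lp.coeFn_zero _ _ _).symm, ?_⟩
    rw [integral_congr_ae (Lp.coeFn_zero _ _ _)]
    simp
  smul_mem' := by
    rintro c q ⟨hq, hq'⟩
    refine ⟨(hq.smul c).congr (Lp.coeFn_smul c q).symm, ?_⟩
    rw [integral_congr_ae (Lp.coeFn_smul c q)]
    simp only [Pi.smul_apply]
    rw [integral_smul, hq', smul_zero]

/-- `𝒳 = H¹₀(Ω, ℂ)ᵈ × L²₀(Ω, ℂ)`, with the norm `‖(v, q)‖ = (‖v‖²_{1,Ω} + ‖q‖²_{0,Ω})^{1/2}`. -/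
abbrev X {d : ℕ} (Ω : Set (Pt d)) := WithLp 2 (H10 Ω × L20 Ω)

section Forms

variable {d : ℕ} {Ω : Set (Pt d)}

/-- The component `vᵢ(x)`. -/
def val (v : H10 Ω) (x : Pt d) (i : Fin d) : ℂ := (v : FieldPair Ω).fst x i

/-- The partial derivative `∂ⱼ vᵢ(x)`. -/
def grad (v : H10 Ω) (x : Pt d) (i j : Fin d) : ℂ := (v : FieldPair Ω).snd x (i, j)

/-- `‖∇v‖_{0,Ω}`. -/
def gradNorm (v : H10 Ω) : ℝ := ‖(v : FieldPair Ω).snd‖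

/-- `div v (x)`. -/
def divg (v : H10 Ω) (x : Pt d) : ℂ := ∑ i, grad v x i i

/-- `a(u, v) = ∫ ν ∇u : ∇v + ∫ (β·∇)u · v`, where `:` and `·` conjugate the second factor. -/
def a (ν : ℝ) (β : Pt d → Pt d) (u v : H10 Ω) : ℂ :=
  (∫ x in Ω, (ν : ℂ) * ∑ i, ∑ j, grad u x i j * conj (grad v x i j)) +
    ∫ x in Ω, ∑ i, (∑ j, (β x j : ℂ) * grad u x i j) * conj (val v x i)

/-- `b(v, q) = -∫ q div v`, as a sesquilinear form: linear in `q`, conjugate linear in `v`. -/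
def b (v : H10 Ω) (q : L20 Ω) : ℂ :=
  - ∫ x in Ω, (q : Lp ℂ 2 (volume.restrict Ω)) x * conj (divg v x)

/-- `A((u, p); (v, q)) = a(u, v) + b(v, p) - b(u, q)`. In the last term the test function is `q`,
whence the conjugate; so `A` is linear in `(u, p)` and conjugate linear in `(v, q)`. -/
def A (ν : ℝ) (β : Pt d → Pt d) (y z : X Ω) : ℂ :=
  a ν β y.fst z.fst + b z.fst y.snd - conj (b y.fst z.snd)

/-- `â(v, w) = ∫ ν ∇v : ∇w + ∫ ∇v : (w ⊗ β)`, where `(w ⊗ β)ᵢⱼ = wᵢ βⱼ`. -/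
def aHat (ν : ℝ) (β : Pt d → Pt d) (v w : H10 Ω) : ℂ :=
  (∫ x in Ω, (ν : ℂ) * ∑ i, ∑ j, grad v x i j * conj (grad w x i j)) +
    ∫ x in Ω, ∑ i, ∑ j, grad v x i j * conj (val w x i * (β x j : ℂ))

/-- `Â((v, q); (w, r)) = â(v, w) - b(v, r) + b(w, q)`, with the conjugate in the term where `r`
is the test function. -/
def AHat (ν : ℝ) (β : Pt d → Pt d) (y z : X Ω) : ℂ :=
  aHat ν β y.fst z.fst - conj (b y.fst z.snd) + b z.fst y.snd

/-! ### Inf-sup values, computed in `[0, ∞]` -/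

/-- `inf_{z ≠ 0} sup_{y ≠ 0} |F(y; z)| / (‖y‖ ‖z‖)`. -/
def infSupRight (F : X Ω → X Ω → ℂ) : ℝ≥0∞ :=
  ⨅ z : {z : X Ω // z ≠ 0}, ⨆ y : {y : X Ω // y ≠ 0},
    ENNReal.ofReal (‖F y.1 z.1‖ / (‖y.1‖ * ‖z.1‖))

/-- `inf_{y ≠ 0} sup_{z ≠ 0} |F(y; z)| / (‖y‖ ‖z‖)`. -/
def infSupLeft (F : X Ω → X Ω → ℂ) : ℝ≥0∞ :=
  ⨅ y : {y : X Ω // y ≠ 0}, ⨆ z : {z : X Ω // z ≠ 0},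
    ENNReal.ofReal (‖F y.1 z.1‖ / (‖y.1‖ * ‖z.1‖))

/-- For each `(v, q)` there is `(w, r)` with `‖w‖_{1,Ω} + ‖r‖_{0,Ω} ≤ C` such that
`F((v, q); (w, r))` is real and at least `‖v‖_{1,Ω} + ‖q‖_{0,Ω}`. -/
def IsStableWith (F : X Ω → X Ω → ℂ) (C : ℝ) : Prop :=
  ∀ y : X Ω, ∃ z : X Ω, ‖z.fst‖ + ‖z.snd‖ ≤ C ∧
    (F y z).im = 0 ∧ ‖y.fst‖ + ‖y.snd‖ ≤ (F y z).re

end Forms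

/-! ### The constants of the domain -/

/-- `Cp` is a Poincaré–Friedrichs constant: `Cp ‖v‖²_{1,Ω} ≤ ‖∇v‖²_{0,Ω}` on `H¹₀(Ω, ℂ)ᵈ`. -/
def IsPoincareConst {d : ℕ} (Ω : Set (Pt d)) (Cp : ℝ) : Prop :=
  0 < Cp ∧ ∀ v : H10 Ω, Cp * ‖v‖ ^ 2 ≤ gradNorm v ^ 2

/-- Each `q ∈ L²₀(Ω, ℂ)` is `-div v` for some `v ∈ H¹₀(Ω, ℂ)ᵈ` with `‖v‖_{1,Ω} ≤ C ‖q‖_{0,Ω}`. -/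
def IsDivConst {d : ℕ} (Ω : Set (Pt d)) (C : ℝ) : Prop :=
  0 < C ∧ ∀ q : L20 Ω, ∃ v : H10 Ω, ‖v‖ ≤ C * ‖q‖ ∧
    ∀ᵐ x ∂(volume.restrict Ω), divg v x = - (q : Lp ℂ 2 (volume.restrict Ω)) x

end Oseen

end

/-!
The forms `A` and `Â` have the same integrands, and `A(y; z) = ⟪z, T y⟫` for a bounded operator `T`
on the Hilbert space `𝒳`. Once `T` is invertible, both inf-sup values equal `γ = 1 / ‖T⁻¹‖`, because
the inverse of the adjoint has the same norm as `T⁻¹`; and `T y`, scaled to the norm `√2 / γ`, is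
the test function required for stability. Hence everything follows from a lower bound for
`F = ‖T y‖`, `y = (u, p)`, plus the density of the range.

The lower bound (`norm_sq_le_saddleOp`) comes from two test functions. As `β` is divergence free,
the convective term is skew (`re_inner_convect`), so that `z = y` gives `ν ‖∇u‖² ≤ F ‖y‖`. A field
`v` with `-div v = p` and `‖v‖ ≤ C ‖p‖` gives `‖p‖ ≤ C (F + (ν + ‖β‖) ‖∇u‖)`. With the Poincaré
inequality this bounds `‖y‖²` by an explicit multiple of `F²`, and the three bounds on `γ` are
elementary consequences; the first of them uses `Cp ≤ 1`.

The Poincaré inequality is an integration by parts against a coordinate function. The right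
inverse of the divergence is built by moving mass. If the mass of a density `f` is transported along
straight paths, the flux is a field whose divergence is the difference of the initial and the final
density (`sum_pderiv_transport`). Near a point `y₀` of the closure of `Ω` the Lipschitz condition
provides a ball of displacements `h` such that `y + t h` stays in `Ω` for `t ∈ [0, 1]`
(`exists_cone`). First `f` is spread over these displacements with a smooth density `η`; this is
a convolution, whose gradient is bounded on `L²` by Plancherel's theorem
(`exists_integral_sq_pderiv_transport_le`), because the multiplier is
`2πi ξⱼ ∫₀¹ ψ̂ᵢ(tξ) dt` with `ψᵢ(h) = hᵢ η(h)`, and `∫₀¹ |ξ| / (1 + t²|ξ|²) dt` is bounded. Then the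
mass at `y + h` is moved to `y₀ + h`, with a flux that has a smooth kernel. So `f` is, up to a
multiple of a fixed bump, the divergence of a controlled test field (`exists_field_of_cone`). A
partition of unity, and the connectedness of `Ω`, which allows bumps of equal mass to be moved to one
place (`exists_field_sub`), show that every test function of mass zero is the divergence of a
controlled test field. These functions are dense in `L²₀`, and the controlled preimages pass to
the closure.
-/

noncomputable section

namespace Oseen

/-! ### Superposition and transport along straight paths -/

section Superposition

variable {P : Type*} [MeasurableSpace P] {E : Type} [NormedAddCommGroup E] [MeasurableSpace E] [BorelSpace E] [SecondCountableTopology E]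

theorem integrable_superposition {F : Type} [NormedAddCommGroup F] [NormedSpace ℂ F]
    {μ : Measure P} {g : P → ℂ} (hg : Integrable g μ) {Φ : P → E} (hΦ : Measurable Φ)
    {f : E → F} (hf : Continuous f) (hc : HasCompactSupport f) (x : E) :
    Integrable (fun p => g p • f (x - Φ p)) μ := by
  obtain ⟨M, hM⟩ := hf.bounded_above_of_compact_support hc
  refine hg.smul_bdd M ?_ (Filter.Eventually.of_forall fun p => hM _)
  exact hf.comp_aestronglyMeasurable (measurable_const.sub hΦ).aestronglyMeasurable

variable [NormedSpace ℝ E]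

/-- A superposition of translates may be differentiated under the integral sign. -/
theorem hasFDerivAt_superposition {F : Type} [NormedAddCommGroup F] [NormedSpace ℂ F]
    [NormedSpace ℝ F] [IsScalarTower ℝ ℂ F] [SMulCommClass ℝ ℂ F]
    {μ : Measure P} {g : P → ℂ} (hg : Integrable g μ) {Φ : P → E} (hΦ : Measurable Φ)
    {f : E → F} (hf : ContDiff ℝ 1 f) (hc : HasCompactSupport f) (x : E) :
    HasFDerivAt (fun x => ∫ p, g p • f (x - Φ p) ∂μ)
      (∫ p, g p • fderiv ℝ f (x - Φ p) ∂μ) x := by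
  obtain ⟨M, hM⟩ := (hf.continuous_fderiv (by simp)).bounded_above_of_compact_support
    (hc.fderiv (𝕜 := ℝ))
  refine hasFDerivAt_integral_of_dominated_of_fderiv_le (𝕜 := ℝ) (s := Set.univ)
    (F := fun y p => g p • f (y - Φ p)) (F' := fun y p => g p • fderiv ℝ f (y - Φ p))
    (bound := fun p => ‖g p‖ * M) Filter.univ_mem
    (Filter.Eventually.of_forall fun x =>
      (integrable_superposition hg hΦ hf.continuous hc x).aestronglyMeasurable)
    (integrable_superposition hg hΦ hf.continuous hc x)
    (integrable_superposition hg hΦ (hf.continuous_fderiv (by simp))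
      (hc.fderiv (𝕜 := ℝ)) x).aestronglyMeasurable ?_ (hg.norm.mul_const M) ?_
  · refine Filter.Eventually.of_forall fun p y _ => ?_
    rw [norm_smul]
    exact mul_le_mul_of_nonneg_left (hM _) (norm_nonneg _)
  · refine Filter.Eventually.of_forall fun p y _ => ?_
    have h1 : HasFDerivAt f (fderiv ℝ f (y - Φ p)) (y - Φ p) :=
      (hf.differentiable (by simp) _).hasFDerivAt
    have h2 := h1.comp y ((hasFDerivAt_id y).sub_const (Φ p))
    exact h2.const_smul (g p)

theorem contDiff_superposition {F : Type} [NormedAddCommGroup F] [NormedSpace ℂ F]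
    [NormedSpace ℝ F] [IsScalarTower ℝ ℂ F] [SMulCommClass ℝ ℂ F]
    {μ : Measure P} {g : P → ℂ} (hg : Integrable g μ) {Φ : P → E} (hΦ : Measurable Φ)
    {f : E → F} (hf : ContDiff ℝ ∞ f) (hc : HasCompactSupport f) :
    ContDiff ℝ ∞ (fun x => ∫ p, g p • f (x - Φ p) ∂μ) := by
  have hd : ∀ x, HasFDerivAt (fun x => ∫ p, g p • f (x - Φ p) ∂μ)
      (∫ p, g p • fderiv ℝ f (x - Φ p) ∂μ) x := fun x =>
    hasFDerivAt_superposition hg hΦ (hf.of_le (by simp)) hc x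
  rw [contDiff_infty]
  intro n
  induction n generalizing F with
  | zero =>
    have h : Differentiable ℝ (fun x => ∫ p, g p • f (x - Φ p) ∂μ) := fun x =>
      (hd x).differentiableAt
    simpa using h.continuous
  | succ n ih =>
    push_cast
    rw [contDiff_succ_iff_fderiv]
    refine ⟨fun x => (hd x).differentiableAt, by simp, ?_⟩
    rw [show fderiv ℝ (fun x => ∫ p, g p • f (x - Φ p) ∂μ)
      = fun x => ∫ p, g p • fderiv ℝ f (x - Φ p) ∂μ from funext fun x => (hd x).fderiv]
    have hf' : ContDiff ℝ ∞ (fderiv ℝ f) := hf.fderiv_right (by simp)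
    have hc' := hc.fderiv (𝕜 := ℝ)
    exact ih hf' hc' fun x => hasFDerivAt_superposition hg hΦ (hf'.of_le (by simp)) hc' x

end Superposition

section Transport

variable {d : ℕ}

/-- The measure `dt dq` on `[0, 1] × ℝᵈ`. -/
abbrev pathMeasure (d : ℕ) : Measure (ℝ × Pt d) :=
  (volume.restrict (Set.Icc (0 : ℝ) 1)).prod volume

/-- The flux of mass with density `c` that is moved along straight paths: the mass at `q` starts as
a copy of `θ` translated by `s q`, and is translated by the displacement `V q` in unit time. -/
def transport (c : Pt d → ℂ) (s V : Pt d → Pt d) (θ : Pt d → ℂ) (i : Fin d) (x : Pt d) : ℂ :=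
  ∫ p : ℝ × Pt d, (c p.2 * (V p.2 i : ℂ)) • θ (x - (s p.2 + p.1 • V p.2)) ∂(pathMeasure d)

variable {c : Pt d → ℂ} {s V : Pt d → Pt d} {θ : Pt d → ℂ}

theorem integrable_weight (hc : Continuous c) (hcc : HasCompactSupport c) (hV : Continuous V)
    (i : Fin d) : Integrable (fun q => c q * (V q i : ℂ)) volume := by
  refine Continuous.integrable_of_hasCompactSupport (by fun_prop) hcc.mul_right

theorem integrable_pathWeight (hc : Continuous c) (hcc : HasCompactSupport c) (hV : Continuous V)
    (i : Fin d) :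
    Integrable (fun p : ℝ × Pt d => c p.2 * (V p.2 i : ℂ)) (pathMeasure d) :=
  (integrable_weight hc hcc hV i).comp_snd _

theorem measurable_path (hs : Continuous s) (hV : Continuous V) :
    Measurable (fun p : ℝ × Pt d => s p.2 + p.1 • V p.2) := by
  refine Continuous.measurable ?_
  fun_prop

theorem contDiff_transport (hc : Continuous c) (hcc : HasCompactSupport c) (hs : Continuous s)
    (hV : Continuous V) (hθ : ContDiff ℝ ∞ θ) (hθc : HasCompactSupport θ) (i : Fin d) :
    ContDiff ℝ ∞ (transport c s V θ i) :=
  contDiff_superposition (integrable_pathWeight hc hcc hV i) (measurable_path hs hV) hθ hθc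

theorem pderiv_transport (hc : Continuous c) (hcc : HasCompactSupport c) (hs : Continuous s)
    (hV : Continuous V) (hθ : ContDiff ℝ ∞ θ) (hθc : HasCompactSupport θ) (i j : Fin d)
    (x : Pt d) :
    pderiv j (transport c s V θ i) x = transport c s V (pderiv j θ) i x := by
  have h := hasFDerivAt_superposition (integrable_pathWeight hc hcc hV i) (measurable_path hs hV)
    (hθ.of_le (by simp)) hθc x
  have h' : fderiv ℝ (transport c s V θ i) x = _ := h.fderiv
  rw [pderiv, h', ContinuousLinearMap.integral_apply]
  · rfl
  · exact integrable_superposition (integrable_pathWeight hc hcc hV i) (measurable_path hs hV)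
      (hθ.continuous_fderiv (by simp)) (hθc.fderiv (𝕜 := ℝ)) x

theorem tsupport_transport_subset {K : Set (Pt d)} (hK : IsClosed K)
    (h : ∀ q ∈ tsupport c, ∀ t ∈ Set.Icc (0 : ℝ) 1, ∀ y ∈ tsupport θ, s q + t • V q + y ∈ K)
    (i : Fin d) : tsupport (transport c s V θ i) ⊆ K := by
  refine closure_minimal (fun x hx => ?_) hK
  by_contra hxK
  refine hx ?_
  have h1 : ∀ᵐ p ∂(pathMeasure d), p.1 ∈ Set.Icc (0 : ℝ) 1 :=
    Measure.quasiMeasurePreserving_fst.ae (ae_restrict_mem measurableSet_Icc)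
  refine integral_eq_zero_of_ae ?_
  filter_upwards [h1] with p hp
  by_cases hq : p.2 ∈ tsupport c
  · have : x - (s p.2 + p.1 • V p.2) ∉ tsupport θ := fun hy => hxK <| by
      simpa using h _ hq _ hp _ hy
    simp [image_eq_zero_of_notMem_tsupport this]
  · simp [image_eq_zero_of_notMem_tsupport hq]

theorem hasCompactSupport_transport (hcc : HasCompactSupport c) (hs : Continuous s)
    (hV : Continuous V) (hθc : HasCompactSupport θ) (i : Fin d) :
    HasCompactSupport (transport c s V θ i) := by
  have hK : IsCompact ((fun p : (Pt d × ℝ) × Pt d => s p.1.1 + p.1.2 • V p.1.1 + p.2) ''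
      ((tsupport c ×ˢ Set.Icc (0 : ℝ) 1) ×ˢ tsupport θ)) :=
    ((hcc.prod isCompact_Icc).prod hθc).image (by fun_prop)
  refine hK.of_isClosed_subset (isClosed_tsupport _)
    (tsupport_transport_subset hK.isClosed (fun q hq t ht y hy => ?_) i)
  exact ⟨((q, t), y), ⟨⟨hq, ht⟩, hy⟩, rfl⟩

theorem fderiv_apply_eq_sum (f : Pt d → ℂ) (x v : Pt d) :
    fderiv ℝ f x v = ∑ i, (v i : ℂ) * pderiv i f x := by
  conv_lhs => rw [← (EuclideanSpace.basisFun (Fin d) ℝ).sum_repr v]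
  simp [pderiv, map_sum]

/-- The divergence of the flux is the initial minus the final density. -/
theorem sum_pderiv_transport (hc : Continuous c) (hcc : HasCompactSupport c) (hs : Continuous s)
    (hV : Continuous V) (hθ : ContDiff ℝ ∞ θ) (hθc : HasCompactSupport θ) (x : Pt d) :
    ∑ i, pderiv i (transport c s V θ i) x =
      (∫ q, c q * θ (x - s q)) - ∫ q, c q * θ (x - (s q + V q)) := by
  have hint : ∀ i, Integrable (fun p : ℝ × Pt d => (c p.2 * (V p.2 i : ℂ)) •
      pderiv i θ (x - (s p.2 + p.1 • V p.2))) (pathMeasure d) := fun i => by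
    refine integrable_superposition (integrable_pathWeight hc hcc hV i) (measurable_path hs hV)
      ?_ ?_ x
    · exact (hθ.continuous_fderiv (by simp)).clm_apply continuous_const
    · exact hθc.fderiv_apply (𝕜 := ℝ) _
  have hint0 : ∀ Φ : Pt d → Pt d, Continuous Φ →
      Integrable (fun q => c q * θ (x - Φ q)) volume := fun Φ hΦ => by
    refine Continuous.integrable_of_hasCompactSupport ?_ hcc.mul_right
    have := hθ.continuous
    fun_prop
  simp_rw [pderiv_transport hc hcc hs hV hθ hθc]
  unfold transport
  rw [← integral_finsetSum _ fun i _ => hint i, integral_prod_symm _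
    (integrable_finsetSum _ fun i _ => hint i), ← integral_sub (hint0 _ hs) (hint0 (fun q => s q + V q) (hs.add hV))]
  refine integral_congr_ae (Filter.Eventually.of_forall fun q => ?_)
  have hder : ∀ t : ℝ, HasDerivAt (fun t : ℝ => -(c q * θ (x - (s q + t • V q))))
      (∑ i, (c q * (V q i : ℂ)) • pderiv i θ (x - (s q + t • V q))) t := fun t => by
    have h1 : HasFDerivAt θ _ (x - (s q + t • V q)) :=
      (hθ.differentiable (by simp) _).hasFDerivAt
    have h2 : HasDerivAt (fun t : ℝ => x - (s q + t • V q)) (-V q) t := by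
      simpa using (((hasDerivAt_id t).smul_const (V q)).const_add (s q)).const_sub x
    have h3 := ((h1.comp_hasDerivAt t h2).const_mul (c q)).neg
    refine h3.congr_deriv ?_
    rw [map_neg, fderiv_apply_eq_sum, mul_neg, neg_neg, Finset.mul_sum]
    exact Finset.sum_congr rfl fun i _ => by simp [mul_assoc]
  have hcont : Continuous fun t : ℝ =>
      ∑ i, (c q * (V q i : ℂ)) • pderiv i θ (x - (s q + t • V q)) := by
    refine continuous_finsetSum _ fun i _ => ?_
    have : Continuous (pderiv i θ) := (hθ.continuous_fderiv (by simp)).clm_apply continuous_const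
    fun_prop
  have := intervalIntegral.integral_eq_sub_of_hasDerivAt (a := 0) (b := 1)
    (fun t _ => hder t) (hcont.intervalIntegrable _ _)
  rw [intervalIntegral.integral_of_le zero_le_one, ← integral_Icc_eq_integral_Ioc] at this
  refine this.trans ?_
  simp
  ring

end Transport

/-! ### The Fourier bound -/

section Fourier

open scoped FourierTransform SchwartzMap
open LineDeriv

variable {d : ℕ}

/-- The multiplier `ξ ↦ |ξ| ∫₀¹ |ψ̂(tξ)| dt` of a Schwartz function `ψ` is bounded, because
`∫₀¹ |ξ| / (1 + t²|ξ|²) dt = arctan |ξ|`. -/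
theorem exists_bound_norm_mul_integral_fourier (ψ : 𝓢(Pt d, ℂ)) :
    ∃ C : ℝ, 0 < C ∧ ∀ ξ : Pt d, ‖ξ‖ * ‖∫ t in Set.Icc (0 : ℝ) 1, 𝓕 ψ (t • ξ)‖ ≤ C := by
  obtain ⟨C0, hC0, h0⟩ := (𝓕 ψ).decay 0 0
  obtain ⟨C2, hC2, h2⟩ := (𝓕 ψ).decay 2 0
  have hdec : ∀ η, ‖𝓕 ψ η‖ ≤ (C0 + C2) * (1 + ‖η‖ ^ 2)⁻¹ := fun η => by
    have a0 := h0 η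
    have a2 := h2 η
    simp only [pow_zero, one_mul, norm_iteratedFDeriv_zero] at a0 a2
    rw [← div_eq_mul_inv, le_div_iff₀ (by positivity)]
    linarith
  have hC : 0 < C0 + C2 := by positivity
  refine ⟨(C0 + C2) * (Real.pi / 2), by positivity, fun ξ => ?_⟩
  have hint : IntervalIntegrable (fun t : ℝ => (C0 + C2) * (1 + (t * ‖ξ‖) ^ 2)⁻¹) volume 0 1 := by
    refine Continuous.intervalIntegrable ?_ _ _
    refine continuous_const.mul (Continuous.inv₀ (by fun_prop) fun t => by positivity)
  have h3 : ‖∫ t in Set.Icc (0 : ℝ) 1, 𝓕 ψ (t • ξ)‖ ≤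
      ∫ t in (0 : ℝ)..1, (C0 + C2) * (1 + (t * ‖ξ‖) ^ 2)⁻¹ := by
    rw [integral_Icc_eq_integral_Ioc, ← intervalIntegral.integral_of_le zero_le_one]
    refine intervalIntegral.norm_integral_le_of_norm_le zero_le_one
      (Filter.Eventually.of_forall fun t _ => ?_) hint
    refine (hdec _).trans (le_of_eq ?_)
    rw [norm_smul, mul_pow, mul_pow, Real.norm_eq_abs, sq_abs]
  have h4 : ‖ξ‖ * ∫ t in (0 : ℝ)..1, (C0 + C2) * (1 + (t * ‖ξ‖) ^ 2)⁻¹ =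
      (C0 + C2) * Real.arctan ‖ξ‖ := by
    rw [intervalIntegral.integral_const_mul, mul_left_comm]
    congr 1
    have := intervalIntegral.smul_integral_comp_mul_right (a := 0) (b := 1)
      (fun t : ℝ => (1 + t ^ 2)⁻¹) ‖ξ‖
    rw [smul_eq_mul] at this
    rw [this, integral_inv_one_add_sq]
    simp
  calc _ ≤ ‖ξ‖ * ∫ t in (0 : ℝ)..1, (C0 + C2) * (1 + (t * ‖ξ‖) ^ 2)⁻¹ := by gcongr
    _ = (C0 + C2) * Real.arctan ‖ξ‖ := h4
    _ ≤ _ := by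
      gcongr
      exact (Real.arctan_lt_pi_div_two _).le

/-- Moving mass along random displacements `h`, distributed with the density `η`, is convolution
with a kernel, and acts on Fourier transforms by a multiplier. -/
theorem fourier_transport {η θ : Pt d → ℂ} (hη : Continuous η) (hηc : HasCompactSupport η)
    (hθ : Continuous θ) (hθc : HasCompactSupport θ) (i : Fin d) (ξ : Pt d) :
    𝓕 (transport η 0 id θ i) ξ =
      (∫ t in Set.Icc (0 : ℝ) 1, 𝓕 (fun h => η h * (h i : ℂ)) (t • ξ)) * 𝓕 θ ξ := by
  have hw := integrable_pathWeight hη hηc continuous_id i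
  have hθi : Integrable θ volume := hθ.integrable_of_hasCompactSupport hθc
  have hprod : Integrable (fun z : Pt d × (ℝ × Pt d) =>
      Real.fourierChar (-inner ℝ z.1 ξ) • ((η z.2.2 * (z.2.2 i : ℂ)) • θ (z.1 - z.2.1 • z.2.2)))
      (volume.prod (pathMeasure d)) := by
    have hmeas : AEStronglyMeasurable (fun z : Pt d × (ℝ × Pt d) =>
      Real.fourierChar (-inner ℝ z.1 ξ) • ((η z.2.2 * (z.2.2 i : ℂ)) • θ (z.1 - z.2.1 • z.2.2)))
      (volume.prod (pathMeasure d)) := by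
      refine Continuous.aestronglyMeasurable ?_
      have := Real.continuous_fourierChar
      fun_prop
    rw [integrable_prod_iff' hmeas]
    constructor
    · refine Filter.Eventually.of_forall fun p => ?_
      have h1 : Integrable (fun x => (η p.2 * (p.2 i : ℂ)) • θ (x - p.1 • p.2)) volume :=
        (hθi.comp_sub_right _).const_mul _
      refine h1.mono (Continuous.aestronglyMeasurable ?_) ?_
      · have := Real.continuous_fourierChar
        fun_prop
      · simp [Circle.norm_smul]
    · simp only [Circle.norm_smul, norm_smul]
      simp_rw [integral_const_mul, integral_sub_right_eq_self (fun x => ‖θ x‖)]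
      exact hw.norm.mul_const _
  rw [Real.fourier_eq]
  have e0 : ∀ x, Real.fourierChar (-inner ℝ x ξ) • transport η 0 id θ i x =
      ∫ p : ℝ × Pt d, Real.fourierChar (-inner ℝ x ξ) •
        ((η p.2 * (p.2 i : ℂ)) • θ (x - p.1 • p.2)) ∂(pathMeasure d) := fun x => by
    simp only [Circle.smul_def]
    rw [integral_smul]
    simp [transport]
  simp_rw [e0]
  have e1 := integral_integral_swap (f := fun x (p : ℝ × Pt d) =>
      Real.fourierChar (-inner ℝ x ξ) • ((η p.2 * (p.2 i : ℂ)) • θ (x - p.1 • p.2))) hprod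
  rw [e1]
  have e2 : ∀ p : ℝ × Pt d, ∫ x, Real.fourierChar (-inner ℝ x ξ) •
      ((η p.2 * (p.2 i : ℂ)) • θ (x - p.1 • p.2)) =
      (Real.fourierChar (-inner ℝ p.2 (p.1 • ξ)) • (η p.2 * (p.2 i : ℂ))) * 𝓕 θ ξ := fun p => by
    rw [Real.fourier_eq, ← integral_const_mul,
      ← integral_sub_right_eq_self (fun x => _ * (Real.fourierChar (-inner ℝ x ξ) • θ x))
        (p.1 • p.2)]
    refine integral_congr_ae (Filter.Eventually.of_forall fun x => ?_)
    simp only [Circle.smul_def, smul_eq_mul]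
    have : (Real.fourierChar (-inner ℝ x ξ) : ℂ) = Real.fourierChar (-inner ℝ p.2 (p.1 • ξ)) *
        Real.fourierChar (-inner ℝ (x - p.1 • p.2) ξ) := by
      rw [← Circle.coe_mul, ← AddChar.map_add_eq_mul]
      congr 2
      rw [inner_sub_left, inner_smul_left, inner_smul_right]
      simp
      ring
    rw [this]
    ring
  simp_rw [e2]
  rw [integral_mul_const, integral_prod]
  · simp_rw [Real.fourier_eq]
  · refine hw.mono (Continuous.aestronglyMeasurable ?_) ?_
    · have := Real.continuous_fourierChar
      fun_prop
    · simp [Circle.norm_smul]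

/-- Spreading a density `θ` along random displacements with a smooth density gains one
derivative in `L²`. -/
theorem exists_integral_sq_pderiv_transport_le {η : Pt d → ℂ} (hη : ContDiff ℝ ∞ η)
    (hηc : HasCompactSupport η) :
    ∃ C : ℝ, 0 < C ∧ ∀ θ : Pt d → ℂ, ContDiff ℝ ∞ θ → HasCompactSupport θ →
      ∀ i j, ∫ x, ‖pderiv j (transport η 0 id θ i) x‖ ^ 2 ≤ C * ∫ x, ‖θ x‖ ^ 2 := by
  have hψ : ∀ i : Fin d, ContDiff ℝ ∞ fun h : Pt d => η h * (h i : ℂ) := fun i => by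
    refine hη.mul (Complex.ofRealCLM.contDiff.comp ?_)
    exact (EuclideanSpace.proj (𝕜 := ℝ) i).contDiff
  have hψc : ∀ i : Fin d, HasCompactSupport fun h : Pt d => η h * (h i : ℂ) := fun i =>
    hηc.mul_right
  choose C hC hb using fun i =>
    exists_bound_norm_mul_integral_fourier ((hψc i).toSchwartzMap (hψ i))
  refine ⟨(2 * Real.pi * ∑ i, C i) ^ 2 + 1, by positivity, fun θ hθ hθc i j => ?_⟩
  have huc : HasCompactSupport (transport η 0 id θ i) :=
    hasCompactSupport_transport hηc continuous_const continuous_id hθc i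
  have hus := contDiff_transport (s := 0) hη.continuous hηc continuous_const continuous_id hθ hθc i
  set U : 𝓢(Pt d, ℂ) := huc.toSchwartzMap hus
  set T : 𝓢(Pt d, ℂ) := hθc.toSchwartzMap hθ
  have e1 : ∫ x, ‖pderiv j (transport η 0 id θ i) x‖ ^ 2 =
      ∫ ξ, ‖𝓕 (∂_{(EuclideanSpace.single j (1 : ℝ) : Pt d)} U) ξ‖ ^ 2 := by
    rw [SchwartzMap.integral_norm_sq_fourier]
    simp only [SchwartzMap.lineDerivOp_apply_eq_fderiv]
    rfl
  have e2 : ∫ x, ‖θ x‖ ^ 2 = ∫ ξ, ‖𝓕 T ξ‖ ^ 2 := by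
    rw [SchwartzMap.integral_norm_sq_fourier]
    rfl
  rw [e1, e2, ← integral_const_mul]
  have hbound : ∀ ξ, ‖𝓕 (∂_{(EuclideanSpace.single j (1 : ℝ) : Pt d)} U) ξ‖ ^ 2 ≤
      ((2 * Real.pi * ∑ i, C i) ^ 2 + 1) * ‖𝓕 T ξ‖ ^ 2 := fun ξ => by
    have hg : (inner ℝ · (EuclideanSpace.single j (1 : ℝ) : Pt d)).HasTemperateGrowth :=
      ((innerSL ℝ).flip (EuclideanSpace.single j (1 : ℝ) : Pt d)).hasTemperateGrowth
    have f1 : 𝓕 (∂_{(EuclideanSpace.single j (1 : ℝ) : Pt d)} U) ξ =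
        (2 * Real.pi * Complex.I) * ((ξ j : ℂ) * 𝓕 U ξ) := by
      rw [SchwartzMap.fourier_lineDerivOp_eq]
      have f0 : inner ℝ ξ (EuclideanSpace.single j (1 : ℝ) : Pt d) = ξ j := by
        rw [real_inner_comm]
        simp [EuclideanSpace.inner_single_left]
      simp [hg, SchwartzMap.smulLeftCLM_apply_apply, f0]
    have f2 : 𝓕 U ξ = (∫ t in Set.Icc (0 : ℝ) 1,
        𝓕 ((hψc i).toSchwartzMap (hψ i)) (t • ξ)) * 𝓕 T ξ := by
      have := fourier_transport hη.continuous hηc hθ.continuous hθc i ξ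
      exact this
    have f3 : ‖(ξ j : ℂ)‖ ≤ ‖ξ‖ := by
      rw [Complex.norm_real]
      exact PiLp.norm_apply_le ξ j
    have f4 : C i ≤ ∑ i, C i := Finset.single_le_sum (fun i _ => (hC i).le) (Finset.mem_univ i)
    have f5 : ‖𝓕 (∂_{(EuclideanSpace.single j (1 : ℝ) : Pt d)} U) ξ‖ ≤
        (2 * Real.pi * ∑ i, C i) * ‖𝓕 T ξ‖ := by
      rw [f1, f2, norm_mul (2 * Real.pi * Complex.I : ℂ), norm_mul (ξ j : ℂ), norm_mul _ (𝓕 T ξ)]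
      have : ‖(2 * Real.pi * Complex.I : ℂ)‖ = 2 * Real.pi := by
        simp [abs_of_pos Real.pi_pos]
      rw [this]
      calc _ ≤ 2 * Real.pi * (‖ξ‖ * (‖∫ t in Set.Icc (0 : ℝ) 1,
              𝓕 ((hψc i).toSchwartzMap (hψ i)) (t • ξ)‖ * ‖𝓕 T ξ‖)) := by gcongr
        _ = 2 * Real.pi * (‖ξ‖ * ‖∫ t in Set.Icc (0 : ℝ) 1,
              𝓕 ((hψc i).toSchwartzMap (hψ i)) (t • ξ)‖) * ‖𝓕 T ξ‖ := by ring
        _ ≤ 2 * Real.pi * (∑ i, C i) * ‖𝓕 T ξ‖ := by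
          gcongr
          exact (hb i ξ).trans f4
    calc _ ≤ ((2 * Real.pi * ∑ i, C i) * ‖𝓕 T ξ‖) ^ 2 := by gcongr
      _ ≤ _ := by
        rw [mul_pow]
        gcongr
        linarith
  refine integral_mono_of_nonneg (Filter.Eventually.of_forall fun ξ => by positivity) ?_
    (Filter.Eventually.of_forall hbound)
  refine Integrable.const_mul ?_ _
  exact (memLp_two_iff_integrable_sq_norm (𝓕 T).continuous.aestronglyMeasurable).1
    ((𝓕 T).memLp 2 volume)

end Fourier

/-! ### The cone condition and test functions -/

section Geometry

variable {d : ℕ} {Ω : Set (Pt d)}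

/-- Moving away from the graph of a Lipschitz function, in the direction of the axis up to a small
error, increases the height above the graph. -/
theorem lipschitz_graph_add_le {e : Pt d} {φ : Pt d → ℝ} {K : NNReal} (he : ‖e‖ = 1)
    (hφ : LipschitzWith K φ) (b w : Pt d) (τ : ℝ) :
    φ ((b + (τ • e + w)) - (inner ℝ e (b + (τ • e + w)) : ℝ) • e)
        - inner ℝ e (b + (τ • e + w)) ≤
      φ (b - (inner ℝ e b : ℝ) • e) - inner ℝ e b + (2 * K + 1) * ‖w‖ - τ := by
  have hee : inner ℝ e e = (1 : ℝ) := by rw [real_inner_self_eq_norm_sq, he, one_pow]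
  have hw : |inner ℝ e w| ≤ ‖w‖ := by
    simpa [he] using abs_real_inner_le_norm e w
  have h1 := hφ.dist_le_mul ((b + (τ • e + w)) - (inner ℝ e (b + (τ • e + w)) : ℝ) • e)
    (b - (inner ℝ e b : ℝ) • e)
  have h2 : ((b + (τ • e + w)) - (inner ℝ e (b + (τ • e + w)) : ℝ) • e)
      - (b - (inner ℝ e b : ℝ) • e) = w - (inner ℝ e w : ℝ) • e := by
    simp only [inner_add_right, inner_smul_right, hee]
    module
  rw [dist_eq_norm, dist_eq_norm, h2] at h1
  have h3 : ‖w - (inner ℝ e w : ℝ) • e‖ ≤ 2 * ‖w‖ := by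
    refine (norm_sub_le _ _).trans ?_
    rw [norm_smul, he, Real.norm_eq_abs]
    linarith
  have h4 : (K : ℝ) * ‖w - (inner ℝ e w : ℝ) • e‖ ≤ K * (2 * ‖w‖) := by gcongr
  have h5 := (le_abs_self _).trans h1
  have h6 : (inner ℝ e (b + (τ • e + w)) : ℝ) = inner ℝ e b + τ + inner ℝ e w := by
    simp only [inner_add_right, inner_smul_right, hee]
    ring
  rw [h6] at h5 ⊢
  have := neg_le_of_abs_le hw
  linarith

/-- The cone condition: near each point of its closure the domain can be translated into its
interior along segments that remain in the domain, with a ball of admissible displacements. -/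
theorem exists_cone (hΩ : IsLipschitzPolyhedralDomain Ω) {y₀ : Pt d} (hy₀ : y₀ ∈ closure Ω) :
    ∃ ε > 0, ∃ δ > 0, ∃ c : Pt d,
      (∀ y ∈ Ω ∩ Metric.ball y₀ ε, ∀ h ∈ Metric.closedBall c δ, ∀ t ∈ Set.Icc (0 : ℝ) 1,
        y + t • h ∈ Ω) ∧
      ∀ y ∈ Metric.ball y₀ ε, ∀ h ∈ Metric.closedBall c δ, y + h ∈ Ω := by
  by_cases hmem : y₀ ∈ Ω
  · obtain ⟨r, hr, hball⟩ := Metric.isOpen_iff.1 hΩ.isOpen y₀ hmem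
    have key : ∀ y ∈ Metric.ball y₀ (r / 2), ∀ h ∈ Metric.closedBall (0 : Pt d) (r / 2),
        ∀ t ∈ Set.Icc (0 : ℝ) 1, y + t • h ∈ Ω := by
      intro y hy h hh t ht
      apply hball
      rw [mem_ball_iff_norm] at hy ⊢
      rw [mem_closedBall_zero_iff] at hh
      have h1 : ‖t • h‖ ≤ r / 2 := by
        rw [norm_smul, Real.norm_of_nonneg ht.1]
        exact (mul_le_of_le_one_left (norm_nonneg _) ht.2).trans hh
      calc ‖y + t • h - y₀‖ = ‖(y - y₀) + t • h‖ := by congr 1; abel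
        _ ≤ ‖y - y₀‖ + ‖t • h‖ := norm_add_le _ _
        _ < r := by linarith
    refine ⟨r / 2, by positivity, r / 2, by positivity, 0, fun y hy => key y hy.2,
      fun y hy h hh => ?_⟩
    simpa using key y hy h hh 1 (by simp)
  · have hfr : y₀ ∈ frontier Ω := ⟨hy₀, by rwa [hΩ.isOpen.interior_eq]⟩
    obtain ⟨e, φ, K, he, hφ, hev⟩ := hΩ.lipschitz y₀ hfr
    obtain ⟨R, hR, hball⟩ := Metric.eventually_nhds_iff_ball.1 hev
    have hle : φ (y₀ - (inner ℝ e y₀ : ℝ) • e) ≤ inner ℝ e y₀ := by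
      by_contra! hlt
      have hc1 : ContinuousAt (fun y : Pt d => (inner ℝ e y : ℝ)) y₀ := by fun_prop
      have hc2 : ContinuousAt (fun y : Pt d => φ (y - (inner ℝ e y : ℝ) • e)) y₀ := by
        have := hφ.continuous
        fun_prop
      have h1 := hc1.eventually_lt hc2 hlt
      obtain ⟨y, hyΩ, h2, h3⟩ := ((mem_closure_iff_frequently.1 hy₀).and_eventually
        (h1.and hev)).exists
      exact lt_asymm h2 (h3.1 hyΩ)
    have hK : (0 : ℝ) ≤ K := K.2
    set τ : ℝ := R / 3 with hτ
    have hτ0 : 0 < τ := by positivity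
    set δ : ℝ := τ / (4 * (K + 1)) with hδ
    have hδ0 : 0 < δ := by positivity
    have hδτ : 2 * ((2 * K + 1) * δ) < τ := by
      have : δ * (4 * (K + 1)) = τ := by rw [hδ]; field_simp
      nlinarith
    have hδ2 : 2 * δ < τ := by nlinarith
    have hsmall : ∀ y ∈ Metric.ball y₀ δ, ∀ h ∈ Metric.closedBall (τ • e) δ,
        ∀ t ∈ Set.Icc (0 : ℝ) 1, y + t • h ∈ Metric.ball y₀ R := by
      intro y hy h hh t ht
      rw [mem_ball_iff_norm] at hy ⊢
      rw [mem_closedBall_iff_norm] at hh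
      have h0 : ‖h‖ ≤ τ + δ := by
        have : ‖τ • e‖ = τ := by rw [norm_smul, he, mul_one, Real.norm_of_nonneg hτ0.le]
        calc ‖h‖ = ‖τ • e + (h - τ • e)‖ := by congr 1; abel
          _ ≤ _ := (norm_add_le _ _).trans (by linarith)
      have h1 : ‖t • h‖ ≤ τ + δ := by
        rw [norm_smul, Real.norm_of_nonneg ht.1]
        exact (mul_le_of_le_one_left (norm_nonneg _) ht.2).trans h0
      calc ‖y + t • h - y₀‖ = ‖(y - y₀) + t • h‖ := by congr 1; abel
        _ ≤ ‖y - y₀‖ + ‖t • h‖ := norm_add_le _ _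
        _ < R := by linarith
    refine ⟨δ, hδ0, δ, hδ0, τ • e, fun y hy h hh t ht => ?_, fun y hy h hh => ?_⟩
    · rw [hball _ (hsmall y hy.2 h hh t ht)]
      have hyb : y ∈ Metric.ball y₀ R := by
        simpa using hsmall y hy.2 h hh 0 (by simp)
      have h1 := (hball y hyb).1 hy.1
      have h2 := lipschitz_graph_add_le he hφ y (t • (h - τ • e)) (t * τ)
      have h3 : y + ((t * τ) • e + t • (h - τ • e)) = y + t • h := by module
      rw [h3, norm_smul, Real.norm_of_nonneg ht.1] at h2
      rw [mem_closedBall_iff_norm] at hh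
      have h4 : (2 * K + 1) * (t * ‖h - τ • e‖) ≤ t * τ := by
        have h5 : (2 * K + 1) * ‖h - τ • e‖ ≤ (2 * K + 1) * δ := by gcongr
        have h6 : (2 * K + 1) * ‖h - τ • e‖ ≤ τ := by nlinarith
        calc _ = t * ((2 * K + 1) * ‖h - τ • e‖) := by ring
          _ ≤ _ := mul_le_mul_of_nonneg_left h6 ht.1
      linarith
    · have hb : y + h ∈ Metric.ball y₀ R := by
        simpa using hsmall y hy h hh 1 (by simp)
      rw [hball _ hb]
      have h2 := lipschitz_graph_add_le he hφ y₀ ((y - y₀) + (h - τ • e)) τ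
      have h3 : y₀ + (τ • e + ((y - y₀) + (h - τ • e))) = y + h := by module
      rw [h3] at h2
      rw [mem_closedBall_iff_norm] at hh
      rw [mem_ball_iff_norm] at hy
      have h4 : ‖(y - y₀) + (h - τ • e)‖ ≤ 2 * δ := (norm_add_le _ _).trans (by linarith)
      have h5 : (2 * K + 1) * ‖(y - y₀) + (h - τ • e)‖ ≤ (2 * K + 1) * (2 * δ) := by gcongr
      linarith

end Geometry

section TestFunctions

variable {d : ℕ} {F : Type*} [NormedAddCommGroup F] [NormedSpace ℝ F]

theorem IsTestFunction.mono {Ω Ω' : Set (Pt d)} {f : Pt d → F} (hf : IsTestFunction Ω f)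
    (h : Ω ⊆ Ω') : IsTestFunction Ω' f :=
  ⟨hf.smooth, hf.compact, hf.support.trans h⟩

theorem IsTestFunction.add {Ω : Set (Pt d)} {f g : Pt d → F} (hf : IsTestFunction Ω f)
    (hg : IsTestFunction Ω g) : IsTestFunction Ω (fun x => f x + g x) :=
  ⟨hf.smooth.add hg.smooth, hf.compact.add hg.compact,
    (tsupport_add f g).trans (Set.union_subset hf.support hg.support)⟩

theorem IsTestFunction.const_mul {Ω : Set (Pt d)} {f : Pt d → ℂ} (c : ℂ)
    (hf : IsTestFunction Ω f) : IsTestFunction Ω (fun x => c * f x) :=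
  ⟨contDiff_const.mul hf.smooth, hf.compact.mul_left,
    tsupport_mul_subset_right.trans hf.support⟩

theorem IsTestFunction.sub {Ω : Set (Pt d)} {f g : Pt d → ℂ} (hf : IsTestFunction Ω f)
    (hg : IsTestFunction Ω g) : IsTestFunction Ω (fun x => f x - g x) := by
  simpa [sub_eq_add_neg] using hf.add (hg.const_mul (-1))

theorem isTestFunction_zero {Ω : Set (Pt d)} : IsTestFunction Ω (fun _ => 0 : Pt d → F) :=
  ⟨contDiff_const, HasCompactSupport.zero, by simp [tsupport]⟩

theorem IsTestFunction.sum {Ω : Set (Pt d)} {ι : Type*} {f : ι → Pt d → F} (s : Finset ι)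
    (hf : ∀ k ∈ s, IsTestFunction Ω (f k)) : IsTestFunction Ω (fun x => ∑ k ∈ s, f k x) := by
  classical
  induction s using Finset.induction_on with
  | empty => simpa using isTestFunction_zero
  | insert k s hk ih =>
    simp_rw [Finset.sum_insert hk]
    exact (hf k (Finset.mem_insert_self _ _)).add
      (ih fun j hj => hf j (Finset.mem_insert_of_mem hj))

theorem IsTestFunction.continuous_pderiv {Ω : Set (Pt d)} {f : Pt d → F}
    (hf : IsTestFunction Ω f) (j : Fin d) : Continuous (pderiv j f) :=
  (hf.smooth.continuous_fderiv (by simp)).clm_apply continuous_const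

theorem IsTestFunction.hasCompactSupport_pderiv {Ω : Set (Pt d)} {f : Pt d → F}
    (hf : IsTestFunction Ω f) (j : Fin d) : HasCompactSupport (pderiv j f) :=
  hf.compact.fderiv_apply (𝕜 := ℝ) _

theorem IsTestFunction.differentiable {Ω : Set (Pt d)} {f : Pt d → F}
    (hf : IsTestFunction Ω f) : Differentiable ℝ f :=
  hf.smooth.differentiable (by simp)

theorem IsTestFunction.pderiv_add {Ω : Set (Pt d)} {f g : Pt d → F} (hf : IsTestFunction Ω f)
    (hg : IsTestFunction Ω g) (j : Fin d) (x : Pt d) :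
    pderiv j (fun x => f x + g x) x = pderiv j f x + pderiv j g x := by
  unfold pderiv
  rw [fderiv_fun_add (hf.differentiable x) (hg.differentiable x)]
  rfl

theorem IsTestFunction.pderiv_const_mul {Ω : Set (Pt d)} {f : Pt d → ℂ} (c : ℂ)
    (hf : IsTestFunction Ω f) (j : Fin d) (x : Pt d) :
    pderiv j (fun x => c * f x) x = c * pderiv j f x := by
  unfold pderiv
  rw [fderiv_const_mul (hf.differentiable x)]
  simp

theorem IsTestFunction.pderiv_sum {Ω : Set (Pt d)} {ι : Type*} {f : ι → Pt d → F} (s : Finset ι)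
    (hf : ∀ k ∈ s, IsTestFunction Ω (f k)) (j : Fin d) (x : Pt d) :
    pderiv j (fun x => ∑ k ∈ s, f k x) x = ∑ k ∈ s, pderiv j (f k) x := by
  unfold pderiv
  rw [fderiv_fun_sum fun k hk => (hf k hk).differentiable x]
  simp

theorem IsTestFunction.integrable {Ω : Set (Pt d)} {f : Pt d → F}
    (hf : IsTestFunction Ω f) : Integrable f volume :=
  hf.smooth.continuous.integrable_of_hasCompactSupport hf.compact

theorem integrable_norm_sq_of_hasCompactSupport {G : Type*} [NormedAddCommGroup G]
    {f : Pt d → G} (hf : Continuous f)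
    (hc : HasCompactSupport f) : Integrable (fun x => ‖f x‖ ^ 2) volume := by
  refine Continuous.integrable_of_hasCompactSupport (by fun_prop) ?_
  exact hc.comp_left (g := fun y => ‖y‖ ^ 2) (by simp)

theorem IsTestFunction.setIntegral_eq {Ω : Set (Pt d)} {f : Pt d → F} {G : Type*}
    [NormedAddCommGroup G] [NormedSpace ℝ G] (hf : IsTestFunction Ω f) {g : F → G} (hg : g 0 = 0) :
    ∫ x in Ω, g (f x) = ∫ x, g (f x) := by
  refine setIntegral_eq_integral_of_forall_compl_eq_zero fun x hx => ?_
  rw [image_eq_zero_of_notMem_tsupport fun h => hx (hf.support h), hg]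

theorem IsTestFunction.setIntegral {Ω : Set (Pt d)} {f : Pt d → F} (hf : IsTestFunction Ω f) :
    ∫ x in Ω, f x = ∫ x, f x :=
  hf.setIntegral_eq (g := id) rfl

/-- The Cauchy–Schwarz inequality against the constant function `1`. -/
theorem sq_integral_norm_le {Ω : Set (Pt d)} (hΩ : volume Ω ≠ ⊤) {f : Pt d → F}
    (hf : IsTestFunction Ω f) :
    (∫ x, ‖f x‖) ^ 2 ≤ (volume Ω).toReal * ∫ x, ‖f x‖ ^ 2 := by
  have : IsFiniteMeasure (volume.restrict Ω) := ⟨by simpa using hΩ.lt_top⟩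
  rw [← hf.setIntegral_eq (g := fun y => ‖y‖) (by simp),
    ← hf.setIntegral_eq (g := fun y => ‖y‖ ^ 2) (by simp)]
  have h1 : Integrable (fun x => ‖f x‖) (volume.restrict Ω) := hf.integrable.norm.integrableOn
  have h2 : Integrable (fun x => ‖f x‖ ^ 2) (volume.restrict Ω) :=
    (integrable_norm_sq_of_hasCompactSupport hf.smooth.continuous hf.compact).integrableOn
  have h3 : ∀ s : ℝ, 0 ≤ (volume Ω).toReal * (s * s) + (-2 * ∫ x in Ω, ‖f x‖) * s +
      ∫ x in Ω, ‖f x‖ ^ 2 := fun s => by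
    have e : ∫ x in Ω, (‖f x‖ - s) ^ 2 = (volume Ω).toReal * (s * s) +
        (-2 * ∫ x in Ω, ‖f x‖) * s + ∫ x in Ω, ‖f x‖ ^ 2 := by
      have : ∀ x, (‖f x‖ - s) ^ 2 = s * s + (-2 * s) * ‖f x‖ + ‖f x‖ ^ 2 := fun x => by ring
      simp_rw [this]
      have h4 : Integrable (fun x => s * s + (-2 * s) * ‖f x‖) (volume.restrict Ω) :=
        (integrable_const _).add (h1.const_mul _)
      rw [integral_add h4 h2,
        integral_add (integrable_const _) (h1.const_mul _), integral_const_mul (-2 * s)]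
      simp [Measure.real]
      ring
    rw [← e]
    exact integral_nonneg fun x => by positivity
  have := discrim_le_zero h3
  rw [discrim] at this
  linarith

/-- A smooth bump of mass one in a given ball. -/
theorem exists_bump (c : Pt d) {δ : ℝ} (hδ : 0 < δ) :
    ∃ η : Pt d → ℂ, IsTestFunction (Metric.closedBall c δ) η ∧ ∫ x, η x = 1 := by
  let B : ContDiffBump c := ⟨δ / 2, δ, by positivity, by linarith⟩
  refine ⟨fun x => ((B.normed volume x : ℝ) : ℂ), ⟨?_, ?_, ?_⟩, ?_⟩
  · exact Complex.ofRealCLM.contDiff.comp B.contDiff_normed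
  · exact B.hasCompactSupport_normed.comp_left (g := fun r : ℝ => (r : ℂ)) (by simp)
  · refine (closure_mono fun x hx => ?_).trans (B.tsupport_normed_eq (μ := volume)).subset
    simpa using hx
  · rw [integral_complex_ofReal, B.integral_normed]
    simp

end TestFunctions

/-! ### Test functions as divergences, locally -/

section Divergence

variable {d : ℕ} {Ω : Set (Pt d)}

/-- The displacements towards `y₀`: the density at `q + h` goes to `y₀ + h`. This transport has a
smooth kernel, so that its derivatives are controlled by the mass. -/
theorem norm_pderiv_transport_le {f η : Pt d → ℂ} {y₀ : Pt d} {ε M : ℝ} (hε : 0 ≤ ε)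
    (hf : IsTestFunction (Metric.ball y₀ ε) f) (hη : ContDiff ℝ ∞ η) (hηc : HasCompactSupport η)
    {j : Fin d} (hM : ∀ x, ‖pderiv j η x‖ ≤ M) (i : Fin d) (x : Pt d) :
    ‖pderiv j (transport f id (fun q => y₀ - q) η i) x‖ ≤ (ε * M) * ∫ q, ‖f q‖ := by
  have hV : Continuous fun q : Pt d => y₀ - q := by fun_prop
  rw [pderiv_transport hf.smooth.continuous hf.compact continuous_id hV hη hηc]
  have hM0 : 0 ≤ M := (norm_nonneg _).trans (hM 0)
  have hi : Integrable (fun p : ℝ × Pt d => (ε * M) * ‖f p.2‖) (pathMeasure d) :=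
    (hf.integrable.norm.comp_snd _).const_mul _
  have e : ∫ p, (ε * M) * ‖f p.2‖ ∂(pathMeasure d) = (ε * M) * ∫ q, ‖f q‖ := by
    rw [integral_const_mul, integral_fun_snd (fun q => ‖f q‖)]
    simp [Measure.real]
  rw [← e]
  refine norm_integral_le_of_norm_le hi (Filter.Eventually.of_forall fun p => ?_)
  rw [norm_smul, norm_mul, Complex.norm_real]
  by_cases hp : p.2 ∈ tsupport f
  · have h1 : ‖(y₀ - p.2) i‖ ≤ ε := by
      refine (PiLp.norm_apply_le _ i).trans ?_
      have := hf.support hp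
      rw [mem_ball_iff_norm'] at this
      exact this.le
    calc _ ≤ ‖f p.2‖ * ε * M := by gcongr; exact hM _
      _ = _ := by ring
  · simp [image_eq_zero_of_notMem_tsupport hp]

/-- On a set with the cone condition every test function supported near `y₀` is, up to a multiple
of a fixed bump, the divergence of a test field that is controlled in `H¹`. The mass at `q` is
first spread over `q + h`, with `h` distributed according to `η`, and then moved to `y₀ + h`. -/
theorem exists_field_of_cone (hΩ : volume Ω ≠ ⊤) {y₀ c : Pt d} {ε δ : ℝ} (hε : 0 < ε)
    (h1 : ∀ y ∈ Ω ∩ Metric.ball y₀ ε, ∀ h ∈ Metric.closedBall c δ, ∀ t ∈ Set.Icc (0 : ℝ) 1,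
      y + t • h ∈ Ω)
    (h2 : ∀ y ∈ Metric.ball y₀ ε, ∀ h ∈ Metric.closedBall c δ, y + h ∈ Ω)
    {η : Pt d → ℂ} (hη : IsTestFunction (Metric.closedBall c δ) η) (hη1 : ∫ x, η x = 1) :
    ∃ C : ℝ, 0 < C ∧ ∀ f : Pt d → ℂ, IsTestFunction (Ω ∩ Metric.ball y₀ ε) f →
      ∃ u : Fin d → Pt d → ℂ, (∀ i, IsTestFunction Ω (u i)) ∧
        (∀ x, ∑ i, pderiv i (u i) x = f x - (∫ y, f y) * η (x - y₀)) ∧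
        ∀ i j, ∫ x in Ω, ‖pderiv j (u i) x‖ ^ 2 ≤ C * ∫ x, ‖f x‖ ^ 2 := by
  obtain ⟨C₁, hC₁, hb₁⟩ := exists_integral_sq_pderiv_transport_le hη.smooth hη.compact
  choose M hM using fun j =>
    (hη.continuous_pderiv j).bounded_above_of_compact_support (hη.hasCompactSupport_pderiv j)
  have hM0 : ∀ j, 0 ≤ M j := fun j => (norm_nonneg _).trans (hM j 0)
  set m := (volume Ω).toReal
  have hm : 0 ≤ m := ENNReal.toReal_nonneg
  refine ⟨2 * C₁ + ∑ j, 2 * (m * ((ε * M j) ^ 2 * m)), ?_, fun f hf => ?_⟩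
  · have : 0 ≤ ∑ j, 2 * (m * ((ε * M j) ^ 2 * m)) := Finset.sum_nonneg fun j _ => by positivity
    linarith
  have hfc := hf.smooth.continuous
  have hηc := hη.smooth.continuous
  have hV : Continuous fun q : Pt d => y₀ - q := by fun_prop
  have ht₁ : ∀ i, IsTestFunction Ω (transport η 0 id f i) := fun i => by
    refine ⟨contDiff_transport hηc hη.compact continuous_const continuous_id hf.smooth hf.compact i,
      hasCompactSupport_transport hη.compact continuous_const continuous_id hf.compact i, ?_⟩
    have hK : IsCompact ((fun p : (Pt d × ℝ) × Pt d => p.2 + p.1.2 • p.1.1) ''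
        ((tsupport η ×ˢ Set.Icc (0 : ℝ) 1) ×ˢ tsupport f)) :=
      ((hη.compact.prod isCompact_Icc).prod hf.compact).image (by fun_prop)
    refine (tsupport_transport_subset hK.isClosed (fun q hq t ht y hy => ?_) i).trans ?_
    · exact ⟨((q, t), y), ⟨⟨hq, ht⟩, hy⟩, by simp [add_comm]⟩
    · rintro _ ⟨⟨⟨q, t⟩, y⟩, ⟨⟨hq, ht⟩, hy⟩, rfl⟩
      exact h1 y (hf.support hy) q (hη.support hq) t ht
  have ht₂ : ∀ i, IsTestFunction Ω (transport f id (fun q => y₀ - q) η i) := fun i => by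
    refine ⟨contDiff_transport hfc hf.compact continuous_id hV hη.smooth hη.compact i,
      hasCompactSupport_transport hf.compact continuous_id hV hη.compact i, ?_⟩
    have hK : IsCompact ((fun p : (Pt d × ℝ) × Pt d => p.1.1 + p.1.2 • (y₀ - p.1.1) + p.2) ''
        ((tsupport f ×ˢ Set.Icc (0 : ℝ) 1) ×ˢ tsupport η)) :=
      ((hf.compact.prod isCompact_Icc).prod hη.compact).image (by fun_prop)
    refine (tsupport_transport_subset hK.isClosed (fun q hq t ht y hy => ?_) i).trans ?_
    · exact ⟨((q, t), y), ⟨⟨hq, ht⟩, hy⟩, rfl⟩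
    · rintro _ ⟨⟨⟨q, t⟩, y⟩, ⟨⟨hq, ht⟩, hy⟩, rfl⟩
      refine h2 _ ?_ y (hη.support hy)
      have hy₀ : y₀ ∈ Metric.ball y₀ ε := Metric.mem_ball_self hε
      exact (convex_ball y₀ ε).add_smul_sub_mem (hf.support hq).2 hy₀ ht
  refine ⟨fun i x => transport η 0 id f i x + transport f id (fun q => y₀ - q) η i x,
    fun i => (ht₁ i).add (ht₂ i), fun x => ?_, fun i j => ?_⟩
  · simp_rw [fun i => (ht₁ i).pderiv_add (ht₂ i) i x]
    rw [Finset.sum_add_distrib, sum_pderiv_transport (s := 0) hηc hη.compact continuous_const continuous_id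
      hf.smooth hf.compact, sum_pderiv_transport hfc hf.compact continuous_id hV hη.smooth
      hη.compact]
    have e1 : ∫ q, η q * f (x - ((0 : Pt d → Pt d) q + id q)) = ∫ q, f q * η (x - id q) := by
      rw [← integral_sub_left_eq_self _ volume x]
      refine integral_congr_ae (Filter.Eventually.of_forall fun q => ?_)
      simp [mul_comm]
    rw [e1]
    simp only [Pi.zero_apply, sub_zero, id, add_sub_cancel]
    rw [integral_mul_const, integral_mul_const, hη1]
    ring
  · simp_rw [(ht₁ i).pderiv_add (ht₂ i) j]
    have : IsFiniteMeasure (volume.restrict Ω) := ⟨by simpa using hΩ.lt_top⟩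
    set I := ∫ x, ‖f x‖ ^ 2
    have hI : 0 ≤ I := integral_nonneg fun x => by positivity
    have hi₁ := integrable_norm_sq_of_hasCompactSupport ((ht₁ i).continuous_pderiv j)
      ((ht₁ i).hasCompactSupport_pderiv j)
    have hp : ∀ x, ‖pderiv j (transport η 0 id f i) x +
        pderiv j (transport f id (fun q => y₀ - q) η i) x‖ ^ 2 ≤
        2 * ‖pderiv j (transport η 0 id f i) x‖ ^ 2 + 2 * ((ε * M j) ^ 2 * (m * I)) := fun x => by
      have a1 := norm_pderiv_transport_le hε.le (hf.mono Set.inter_subset_right) hη.smooth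
        hη.compact (hM j) i x
      have a2 := sq_integral_norm_le hΩ (hf.mono Set.inter_subset_left)
      have a3 : ‖pderiv j (transport f id (fun q => y₀ - q) η i) x‖ ^ 2 ≤
          (ε * M j) ^ 2 * (m * I) := by
        calc _ ≤ ((ε * M j) * ∫ q, ‖f q‖) ^ 2 := by gcongr
          _ ≤ _ := by rw [mul_pow]; gcongr
      have a4 := norm_add_le (pderiv j (transport η 0 id f i) x)
        (pderiv j (transport f id (fun q => y₀ - q) η i) x)
      calc _ ≤ (‖pderiv j (transport η 0 id f i) x‖ +
            ‖pderiv j (transport f id (fun q => y₀ - q) η i) x‖) ^ 2 := by gcongr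
        _ ≤ 2 * ‖pderiv j (transport η 0 id f i) x‖ ^ 2 +
            2 * ‖pderiv j (transport f id (fun q => y₀ - q) η i) x‖ ^ 2 := by
          linarith [add_sq_le (a := ‖pderiv j (transport η 0 id f i) x‖)
            (b := ‖pderiv j (transport f id (fun q => y₀ - q) η i) x‖)]
        _ ≤ _ := by linarith
    have hi₂ : Integrable (fun x => 2 * ‖pderiv j (transport η 0 id f i) x‖ ^ 2 +
        2 * ((ε * M j) ^ 2 * (m * I))) (volume.restrict Ω) :=
      (hi₁.integrableOn.const_mul 2).add (integrable_const _)
    calc _ ≤ ∫ x in Ω, (2 * ‖pderiv j (transport η 0 id f i) x‖ ^ 2 +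
            2 * ((ε * M j) ^ 2 * (m * I))) :=
          integral_mono_of_nonneg (Filter.Eventually.of_forall fun x => by positivity) hi₂
            (Filter.Eventually.of_forall hp)
      _ = 2 * (∫ x in Ω, ‖pderiv j (transport η 0 id f i) x‖ ^ 2) +
            m * (2 * ((ε * M j) ^ 2 * (m * I))) := by
          rw [integral_add (hi₁.integrableOn.const_mul 2) (integrable_const _),
            integral_const_mul]
          simp [Measure.real, m]
      _ ≤ 2 * (C₁ * I) + (2 * (m * ((ε * M j) ^ 2 * m))) * I := by
          have := (setIntegral_le_integral hi₁ (s := Ω)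
            (Filter.Eventually.of_forall fun x => by positivity)).trans
            (hb₁ f hf.smooth hf.compact i j)
          linarith
      _ ≤ 2 * (C₁ * I) + (∑ j, 2 * (m * ((ε * M j) ^ 2 * m))) * I := by
          gcongr
          exact Finset.single_le_sum (f := fun j => 2 * (m * ((ε * M j) ^ 2 * m)))
            (fun j _ => by positivity) (Finset.mem_univ j)
      _ = _ := by ring

/-- A test function of mass zero in a ball is the divergence of a test field in the ball. -/
theorem exists_field_of_ball {x₀ : Pt d} {r : ℝ} {f : Pt d → ℂ}
    (hf : IsTestFunction (Metric.ball x₀ r) f) (hf0 : ∫ x, f x = 0) :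
    ∃ u : Fin d → Pt d → ℂ, (∀ i, IsTestFunction (Metric.ball x₀ r) (u i)) ∧
      ∀ x, ∑ i, pderiv i (u i) x = f x := by
  rcases le_or_gt r 0 with hr | hr
  · refine ⟨fun _ _ => 0, fun _ => isTestFunction_zero, fun x => ?_⟩
    have : x ∉ tsupport f := fun hx => by
      have := hf.support hx
      rw [Metric.ball_eq_empty.2 hr] at this
      exact this
    simp [pderiv, image_eq_zero_of_notMem_tsupport this]
  obtain ⟨r', ⟨hr', hr'r⟩, hsub⟩ := exists_pos_lt_subset_ball hr (isClosed_tsupport f) hf.support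
  obtain ⟨η, hη, hη1⟩ := exists_bump (0 : Pt d) (sub_pos.2 hr'r)
  have key : ∀ y ∈ Metric.ball x₀ r', ∀ h ∈ Metric.closedBall (0 : Pt d) (r - r'),
      ∀ t ∈ Set.Icc (0 : ℝ) 1, y + t • h ∈ Metric.ball x₀ r := by
    intro y hy h hh t ht
    rw [mem_ball_iff_norm] at hy ⊢
    rw [mem_closedBall_zero_iff] at hh
    have h1 : ‖t • h‖ ≤ r - r' := by
      rw [norm_smul, Real.norm_of_nonneg ht.1]
      exact (mul_le_of_le_one_left (norm_nonneg _) ht.2).trans hh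
    calc ‖y + t • h - x₀‖ = ‖(y - x₀) + t • h‖ := by congr 1; abel
      _ ≤ ‖y - x₀‖ + ‖t • h‖ := norm_add_le _ _
      _ < r := by linarith
  obtain ⟨C, -, hC⟩ := exists_field_of_cone (Ω := Metric.ball x₀ r)
    measure_ball_lt_top.ne hr' (fun y hy => key y hy.2)
    (fun y hy h hh => by simpa using key y hy h hh 1 (by simp)) hη hη1
  obtain ⟨u, hu, hdiv, -⟩ := hC f ⟨hf.smooth, hf.compact, Set.subset_inter hf.support hsub⟩
  exact ⟨u, hu, fun x => by rw [hdiv, hf0, zero_mul, sub_zero]⟩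

/-- In a connected open set two densities of mass one, each supported in a ball, differ by the
divergence of a test field. -/
theorem exists_field_sub (hΩ : IsOpen Ω) (hc : IsPreconnected Ω) {x y : Pt d} {r s : ℝ}
    (hr : 0 < r) (hs : 0 < s) (hx : Metric.ball x r ⊆ Ω) (hy : Metric.ball y s ⊆ Ω)
    {g h : Pt d → ℂ} (hg : IsTestFunction (Metric.ball x r) g) (hg1 : ∫ z, g z = 1)
    (hh : IsTestFunction (Metric.ball y s) h) (hh1 : ∫ z, h z = 1) :
    ∃ u : Fin d → Pt d → ℂ, (∀ i, IsTestFunction Ω (u i)) ∧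
      ∀ z, ∑ i, pderiv i (u i) z = g z - h z := by
  -- `E g h`: the difference of `g` and `h` is a divergence
  let E : (Pt d → ℂ) → (Pt d → ℂ) → Prop := fun g h =>
    ∃ u : Fin d → Pt d → ℂ, (∀ i, IsTestFunction Ω (u i)) ∧
      ∀ z, ∑ i, pderiv i (u i) z = g z - h z
  have hneg : ∀ {g h}, E g h → E h g := by
    rintro g h ⟨u, hu, hd⟩
    refine ⟨fun i z => (-1) * u i z, fun i => (hu i).const_mul _, fun z => ?_⟩
    rw [← neg_sub, ← hd, ← Finset.sum_neg_distrib]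
    exact Finset.sum_congr rfl fun i _ => by rw [(hu i).pderiv_const_mul, neg_one_mul]
  have htrans : ∀ {g h k}, E g h → E h k → E g k := by
    rintro g h k ⟨u, hu, hd⟩ ⟨v, hv, hd'⟩
    refine ⟨fun i z => u i z + v i z, fun i => (hu i).add (hv i), fun z => ?_⟩
    rw [← sub_add_sub_cancel (g z) (h z), ← hd, ← hd', ← Finset.sum_add_distrib]
    exact Finset.sum_congr rfl fun i _ => (hu i).pderiv_add (hv i) i z
  have hball : ∀ {x r g h}, Metric.ball x r ⊆ Ω → IsTestFunction (Metric.ball x r) g →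
      IsTestFunction (Metric.ball x r) h → ∫ z, g z = 1 → ∫ z, h z = 1 → E g h := by
    intro x r g h hx hg hh hg1 hh1
    obtain ⟨u, hu, hd⟩ := exists_field_of_ball (hg.sub hh) (by
      rw [integral_sub hg.integrable hh.integrable, hg1, hh1, sub_self])
    exact ⟨u, fun i => (hu i).mono hx, hd⟩
  let P : Pt d → Pt d → Prop := fun x y => ∀ r s, 0 < r → 0 < s → Metric.ball x r ⊆ Ω →
    Metric.ball y s ⊆ Ω → ∀ g h, IsTestFunction (Metric.ball x r) g → ∫ z, g z = 1 →
    IsTestFunction (Metric.ball y s) h → ∫ z, h z = 1 → E g h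
  have hP : P x y := by
    refine hc.induction₂ P (fun x hx => ?_) (fun x y z _ hy _ h1 h2 => ?_) (fun x y _ _ h1 => ?_)
      (hx (Metric.mem_ball_self hr)) (hy (Metric.mem_ball_self hs))
    · obtain ⟨R, hR, hxR⟩ := Metric.isOpen_iff.1 hΩ x hx
      filter_upwards [mem_nhdsWithin_of_mem_nhds (Metric.ball_mem_nhds x hR)] with y hy
      intro r s hr hs hxr hys g h hg hg1 hh hh1
      obtain ⟨ρ, hρ, hρy⟩ := Metric.isOpen_iff.1 (Metric.isOpen_ball (x := x) (ε := R)) y hy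
      have hρ' : 0 < min (ρ / 2) (s / 2) := by positivity
      obtain ⟨k, hk, hk1⟩ := exists_bump y hρ'
      have hkx : IsTestFunction (Metric.ball x R) k := hk.mono
        ((Metric.closedBall_subset_ball ((min_le_left _ _).trans_lt (by linarith))).trans hρy)
      have hky : IsTestFunction (Metric.ball y s) k := hk.mono
        (Metric.closedBall_subset_ball ((min_le_right _ _).trans_lt (by linarith)))
      have hmax : Metric.ball x (max r R) ⊆ Ω := by
        rcases max_choice r R with h | h <;> rw [h] <;> assumption
      exact htrans (hball hmax (hg.mono (Metric.ball_subset_ball (le_max_left _ _)))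
        (hkx.mono (Metric.ball_subset_ball (le_max_right _ _))) hg1 hk1)
        (hball hys hky hh hk1 hh1)
    · intro r s hr hs hxr hzs g h hg hg1 hh hh1
      obtain ⟨ρ, hρ, hρy⟩ := Metric.isOpen_iff.1 hΩ y hy
      obtain ⟨k, hk, hk1⟩ := exists_bump y (half_pos hρ)
      have hk' : IsTestFunction (Metric.ball y ρ) k :=
        hk.mono (Metric.closedBall_subset_ball (by linarith))
      exact htrans (h1 r ρ hr hρ hxr hρy g k hg hg1 hk' hk1)
        (h2 ρ s hρ hs hρy hzs k h hk' hk1 hh hh1)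
    · intro r s hr hs hxr hys g h hg hg1 hh hh1
      exact hneg (h1 s r hs hr hys hxr h g hh hh1 hg hg1)
  exact hP r s hr hs hx hy g h hg hg1 hh hh1

end Divergence

/-! ### Test functions of mass zero as divergences -/

section Global

variable {d : ℕ} {Ω : Set (Pt d)}

/-- Local solvability at a point of the closure, with a bump `η₀` that does not depend on the
point. -/
theorem exists_field_local (hΩ : IsLipschitzPolyhedralDomain Ω) {η₀ : Pt d → ℂ} {x₀ : Pt d}
    {r : ℝ} (hr : 0 < r) (hx₀ : Metric.ball x₀ r ⊆ Ω) (hη₀ : IsTestFunction (Metric.ball x₀ r) η₀)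
    (hη₀1 : ∫ x, η₀ x = 1) {y₀ : Pt d} (hy₀ : y₀ ∈ closure Ω) :
    ∃ ε > 0, ∃ C : ℝ, 0 < C ∧ ∀ f : Pt d → ℂ, IsTestFunction (Ω ∩ Metric.ball y₀ ε) f →
      ∃ u : Fin d → Pt d → ℂ, (∀ i, IsTestFunction Ω (u i)) ∧
        (∀ x, ∑ i, pderiv i (u i) x = f x - (∫ y, f y) * η₀ x) ∧
        ∀ i j, ∫ x in Ω, ‖pderiv j (u i) x‖ ^ 2 ≤ C * ∫ x, ‖f x‖ ^ 2 := by
  have hvol : volume Ω ≠ ⊤ := hΩ.isBounded.measure_lt_top.ne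
  obtain ⟨ε, hε, δ, hδ, c, h1, h2⟩ := exists_cone hΩ hy₀
  obtain ⟨η, hη, hη1⟩ := exists_bump c (half_pos hδ)
  have hη' := hη.mono (Metric.closedBall_subset_closedBall (half_le_self hδ.le))
  obtain ⟨C, hC, hb⟩ := exists_field_of_cone hvol hε h1 h2 hη' hη1
  have hball : Metric.ball (y₀ + c) δ ⊆ Ω := fun z hz => by
    have := h2 y₀ (Metric.mem_ball_self hε) (z - y₀) (by
      rw [mem_closedBall_iff_norm, sub_sub]
      exact (mem_ball_iff_norm.1 hz).le)
    simpa using this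
  have hshift : IsTestFunction (Metric.ball (y₀ + c) δ) fun x => η (x - y₀) := by
    refine ⟨hη.smooth.comp (contDiff_id.sub contDiff_const),
      hη.compact.comp_homeomorph (Homeomorph.subRight y₀), fun x hx => ?_⟩
    have h3 : x - y₀ ∈ tsupport η :=
      tsupport_comp_subset_preimage η (f := fun x : Pt d => x - y₀) (by fun_prop) hx
    have h4 := hη.support h3
    rw [mem_closedBall_iff_norm, sub_sub] at h4
    rw [mem_ball_iff_norm]
    linarith
  obtain ⟨w, hw, hwd⟩ := exists_field_sub hΩ.isOpen hΩ.isConnected.isPreconnected hδ hr hball hx₀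
    hshift (by rw [integral_sub_right_eq_self (fun x => η x), hη1]) hη₀ hη₀1
  set m := (volume Ω).toReal
  have hm : 0 ≤ m := ENNReal.toReal_nonneg
  set W : Fin d → Fin d → ℝ := fun i j => ∫ x in Ω, ‖pderiv j (w i) x‖ ^ 2
  have hW : ∀ i j, 0 ≤ W i j := fun i j => integral_nonneg fun x => by positivity
  refine ⟨ε, hε, 2 * C + ∑ i, ∑ j, 2 * (m * W i j), ?_, fun f hf => ?_⟩
  · have : 0 ≤ ∑ i, ∑ j, 2 * (m * W i j) := Finset.sum_nonneg fun i _ =>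
      Finset.sum_nonneg fun j _ => mul_nonneg zero_le_two (mul_nonneg hm (hW i j))
    linarith
  obtain ⟨u, hu, hud, hub⟩ := hb f hf
  set κ := ∫ y, f y
  refine ⟨fun i x => u i x + κ * w i x, fun i => (hu i).add ((hw i).const_mul κ), fun x => ?_,
    fun i j => ?_⟩
  · simp_rw [fun i => (hu i).pderiv_add ((hw i).const_mul κ) i x,
      fun i => (hw i).pderiv_const_mul κ i x]
    rw [Finset.sum_add_distrib, ← Finset.mul_sum, hud, hwd]
    ring
  · simp_rw [(hu i).pderiv_add ((hw i).const_mul κ) j, (hw i).pderiv_const_mul κ j]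
    set I := ∫ x, ‖f x‖ ^ 2
    have hI : 0 ≤ I := integral_nonneg fun x => by positivity
    have hκ : ‖κ‖ ^ 2 ≤ m * I := by
      calc ‖κ‖ ^ 2 ≤ (∫ x, ‖f x‖) ^ 2 := by gcongr; exact norm_integral_le_integral_norm _
        _ ≤ _ := sq_integral_norm_le hvol (hf.mono Set.inter_subset_left)
    have i1 := (integrable_norm_sq_of_hasCompactSupport ((hu i).continuous_pderiv j)
      ((hu i).hasCompactSupport_pderiv j)).integrableOn (s := Ω)
    have i2 := (integrable_norm_sq_of_hasCompactSupport ((hw i).continuous_pderiv j)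
      ((hw i).hasCompactSupport_pderiv j)).integrableOn (s := Ω)
    calc _ ≤ ∫ x in Ω, (2 * ‖pderiv j (u i) x‖ ^ 2 + (2 * ‖κ‖ ^ 2) * ‖pderiv j (w i) x‖ ^ 2) := by
          refine integral_mono_of_nonneg (Filter.Eventually.of_forall fun x => by positivity)
            ((i1.const_mul _).add (i2.const_mul _)) (Filter.Eventually.of_forall fun x => ?_)
          have a1 := norm_add_le (pderiv j (u i) x) (κ * pderiv j (w i) x)
          rw [norm_mul] at a1
          calc _ ≤ (‖pderiv j (u i) x‖ + ‖κ‖ * ‖pderiv j (w i) x‖) ^ 2 := by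
                simp only
                gcongr
            _ ≤ _ := by
                linarith [add_sq_le (a := ‖pderiv j (u i) x‖) (b := ‖κ‖ * ‖pderiv j (w i) x‖)]
      _ = 2 * (∫ x in Ω, ‖pderiv j (u i) x‖ ^ 2) + (2 * ‖κ‖ ^ 2) * W i j := by
          rw [integral_add (i1.const_mul _) (i2.const_mul _), integral_const_mul,
            integral_const_mul]
      _ ≤ 2 * (C * I) + (2 * (m * I)) * W i j := by
          have := hub i j
          have := hW i j
          gcongr
      _ = 2 * (C * I) + (2 * (m * W i j)) * I := by ring
      _ ≤ 2 * (C * I) + (∑ i, ∑ j, 2 * (m * W i j)) * I := by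
          gcongr
          have hn : ∀ i j, 0 ≤ 2 * (m * W i j) := fun i j =>
            mul_nonneg zero_le_two (mul_nonneg hm (hW i j))
          exact (Finset.single_le_sum (f := fun j => 2 * (m * W i j)) (fun j _ => hn i j)
            (Finset.mem_univ j)).trans (Finset.single_le_sum
              (f := fun i => ∑ j, 2 * (m * W i j))
              (fun i _ => Finset.sum_nonneg fun j _ => hn i j) (Finset.mem_univ i))
      _ = _ := by ring

/-- Every test function of mass zero in a bounded connected Lipschitz domain is the divergence of a
test field whose gradient it controls in `L²`. -/
theorem exists_field_of_integral_eq_zero (hΩ : IsLipschitzPolyhedralDomain Ω) :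
    ∃ C : ℝ, 0 < C ∧ ∀ f : Pt d → ℂ, IsTestFunction Ω f → ∫ x, f x = 0 →
      ∃ u : Fin d → Pt d → ℂ, (∀ i, IsTestFunction Ω (u i)) ∧
        (∀ x, ∑ i, pderiv i (u i) x = f x) ∧
        ∀ i j, ∫ x in Ω, ‖pderiv j (u i) x‖ ^ 2 ≤ C * ∫ x, ‖f x‖ ^ 2 := by
  obtain ⟨x₀, hx₀⟩ := hΩ.isConnected.nonempty
  obtain ⟨r, hr, hball⟩ := Metric.isOpen_iff.1 hΩ.isOpen x₀ hx₀
  obtain ⟨η₀, hη₀, hη₀1⟩ := exists_bump x₀ (half_pos hr)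
  have hη₀' := hη₀.mono (Metric.closedBall_subset_ball (half_lt_self hr))
  choose! ε hε C hC hloc using fun (y₀ : Pt d) (hy₀ : y₀ ∈ closure Ω) =>
    exists_field_local hΩ hr hball hη₀' hη₀1 hy₀
  have hcpt : IsCompact (closure Ω) := hΩ.isBounded.isCompact_closure
  obtain ⟨t, htc, htcov⟩ := hcpt.elim_nhds_subcover (fun y => Metric.ball y (ε y))
    fun y hy => Metric.ball_mem_nhds y (hε y hy)
  obtain ⟨ρ, hρ⟩ := SmoothPartitionOfUnity.exists_isSubordinate (modelWithCornersSelf ℝ (Pt d))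
    (isClosed_closure (s := Ω)) (fun k : t => Metric.ball (k : Pt d) (ε k))
    (fun k => Metric.isOpen_ball) (by simpa [Set.iUnion_subtype] using htcov)
  have hsum : ∀ x ∈ Ω, ∑ k, ρ k x = 1 := fun x hx => by
    have := ρ.sum_eq_one (subset_closure hx)
    rwa [finsum_eq_sum_of_fintype] at this
  have hCs : 0 ≤ ∑ k : t, C k := Finset.sum_nonneg fun k _ => (hC k (htc k k.2)).le
  refine ⟨(Fintype.card t) * ∑ k : t, C k + 1, by positivity, fun f hf hf0 => ?_⟩
  have hpf : ∀ k : t, IsTestFunction (Ω ∩ Metric.ball (k : Pt d) (ε k)) fun x => (ρ k x : ℂ) * f x :=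
    fun k => by
      refine ⟨(Complex.ofRealCLM.contDiff.comp (ρ k).contMDiff.contDiff).mul hf.smooth,
        hf.compact.mul_left, Set.subset_inter
          (tsupport_mul_subset_right.trans hf.support) ?_⟩
      refine (tsupport_mul_subset_left.trans ?_).trans (hρ k)
      exact closure_mono fun x hx => by simpa using hx
  choose u hu hud hub using fun k : t => hloc k (htc k k.2) _ (hpf k)
  refine ⟨fun i x => ∑ k, u k i x, fun i => IsTestFunction.sum _ fun k _ => hu k i, fun x => ?_,
    fun i j => ?_⟩
  · have hf1 : ∀ x, ∑ k, (ρ k x : ℂ) * f x = f x := fun x => by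
      by_cases hx : x ∈ Ω
      · rw [← Finset.sum_mul, ← Complex.ofReal_sum, hsum x hx]
        simp
      · simp [image_eq_zero_of_notMem_tsupport fun h => hx (hf.support h)]
    simp_rw [fun i => IsTestFunction.pderiv_sum Finset.univ (fun k _ => hu k i) i x]
    rw [Finset.sum_comm]
    simp_rw [hud]
    rw [Finset.sum_sub_distrib, hf1, ← Finset.sum_mul,
      ← integral_finsetSum _ fun k _ => (hpf k).integrable]
    simp_rw [hf1]
    rw [hf0]
    ring
  · simp_rw [IsTestFunction.pderiv_sum Finset.univ (fun k _ => hu k i) j]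
    have hint : ∀ k, IntegrableOn (fun x => ‖pderiv j (u k i) x‖ ^ 2) Ω := fun k =>
      (integrable_norm_sq_of_hasCompactSupport ((hu k i).continuous_pderiv j)
        ((hu k i).hasCompactSupport_pderiv j)).integrableOn
    have hle : ∀ k, ∫ x, ‖(ρ k x : ℂ) * f x‖ ^ 2 ≤ ∫ x, ‖f x‖ ^ 2 := fun k => by
      refine integral_mono_of_nonneg (Filter.Eventually.of_forall fun x => by positivity)
        (integrable_norm_sq_of_hasCompactSupport hf.smooth.continuous hf.compact)
        (Filter.Eventually.of_forall fun x => ?_)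
      simp only [norm_mul, Complex.norm_real]
      have h1 : ‖ρ k x‖ ≤ 1 := by
        rw [Real.norm_of_nonneg (ρ.nonneg k x)]
        exact ρ.le_one k x
      gcongr
      exact mul_le_of_le_one_left (norm_nonneg _) h1
    have hI : 0 ≤ ∫ x, ‖f x‖ ^ 2 := integral_nonneg fun x => by positivity
    calc _ ≤ ∫ x in Ω, (Fintype.card t) * ∑ k, ‖pderiv j (u k i) x‖ ^ 2 := by
          refine integral_mono_of_nonneg (Filter.Eventually.of_forall fun x => by positivity)
            ((integrable_finsetSum _ fun k _ => hint k).const_mul _)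
            (Filter.Eventually.of_forall fun x => ?_)
          calc _ ≤ (∑ k, ‖pderiv j (u k i) x‖) ^ 2 := by
                simp only
                gcongr
                exact norm_sum_le _ _
            _ ≤ _ := sq_sum_le_card_mul_sum_sq
      _ = (Fintype.card t) * ∑ k, ∫ x in Ω, ‖pderiv j (u k i) x‖ ^ 2 := by
          rw [integral_const_mul, integral_finsetSum _ fun k _ => hint k]
      _ ≤ (Fintype.card t) * ∑ k : t, C k * ∫ x, ‖f x‖ ^ 2 := by
          gcongr with k
          have := (hC k (htc k k.2)).le
          exact (hub k i j).trans (mul_le_mul_of_nonneg_left (hle k) this)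
      _ ≤ _ := by
          rw [← Finset.sum_mul]
          linarith

end Global

/-! ### Test fields in `H¹₀` -/

section Spaces

variable {d : ℕ} {Ω : Set (Pt d)}

theorem norm_sq_eq_integral {E : Type*} [NormedAddCommGroup E] [InnerProductSpace ℂ E]
    {μ : Measure (Pt d)} (f : Lp E 2 μ) : ‖f‖ ^ 2 = ∫ x, ‖f x‖ ^ 2 ∂μ := by
  have h : inner ℂ f f = ∫ x, inner ℂ (f x) (f x) ∂μ := L2.inner_def f f
  have h2 : (∫ x, inner ℂ (f x) (f x) ∂μ : ℂ) = ((∫ x, ‖f x‖ ^ 2 ∂μ : ℝ) : ℂ) := by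
    rw [← integral_complex_ofReal]
    refine integral_congr_ae (Filter.Eventually.of_forall fun x => ?_)
    simp only [inner_self_eq_norm_sq_to_K]
    norm_cast
  rw [h2, inner_self_eq_norm_sq_to_K] at h
  exact Complex.ofReal_injective (by rw [Complex.ofReal_pow]; exact h)

/-- A test field together with its gradient, as an element of `H¹₀(Ω, ℂ)ᵈ`. -/
theorem exists_mem_testFields {u : Fin d → Pt d → ℂ} (hu : ∀ i, IsTestFunction Ω (u i)) :
    ∃ z ∈ testFields Ω, (∀ᵐ x ∂(volume.restrict Ω), ∀ i, z.fst x i = u i x) ∧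
      ∀ᵐ x ∂(volume.restrict Ω), ∀ i j, z.snd x (i, j) = pderiv j (u i) x := by
  have h1 : MemLp (fun x => WithLp.toLp 2 fun i => u i x : Pt d → EuclideanSpace ℂ (Fin d)) 2
      (volume.restrict Ω) := MemLp.of_eval_piLp fun i =>
    ((hu i).smooth.continuous.memLp_of_hasCompactSupport (hu i).compact).restrict Ω
  have h2 : MemLp (fun x => WithLp.toLp 2 fun p => pderiv p.2 (u p.1) x :
      Pt d → EuclideanSpace ℂ (Fin d × Fin d)) 2 (volume.restrict Ω) := MemLp.of_eval_piLp fun p =>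
    (((hu p.1).continuous_pderiv p.2).memLp_of_hasCompactSupport
      ((hu p.1).hasCompactSupport_pderiv p.2)).restrict Ω
  have e1 : ∀ᵐ x ∂(volume.restrict Ω), ∀ i, h1.toLp _ x i = u i x := by
    filter_upwards [h1.coeFn_toLp] with x hx i
    rw [hx]
  have e2 : ∀ᵐ x ∂(volume.restrict Ω), ∀ i j, h2.toLp _ x (i, j) = pderiv j (u i) x := by
    filter_upwards [h2.coeFn_toLp] with x hx i j
    rw [hx]
  exact ⟨WithLp.toLp 2 (h1.toLp _, h2.toLp _), ⟨u, hu, e1, e2⟩, e1, e2⟩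

theorem testFields_le_H10 : testFields Ω ≤ H10 Ω := Submodule.le_topologicalClosure _

/-- A closed condition on `H¹₀` only has to be checked for test fields. -/
theorem H10_induction {p : FieldPair Ω → Prop} (hp : IsClosed {z | p z})
    (h : ∀ z ∈ testFields Ω, p z) (v : H10 Ω) : p v :=
  closure_minimal (s := (testFields Ω : Set (FieldPair Ω))) h hp v.2

/-! ### The Poincaré inequality -/

theorem integral_pderiv_eq_zero {f : Pt d → ℂ} (hf : IsTestFunction Ω f) (j : Fin d) :
    ∫ x, pderiv j f x = 0 := by
  have h := integral_mul_fderiv_eq_neg_fderiv_mul_of_integrable (μ := volume)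
    (f := fun _ : Pt d => (1 : ℂ)) (g := f) (v := (EuclideanSpace.single j 1 : Pt d))
    (by simp) (by
      simp only [one_mul]
      exact (hf.continuous_pderiv j).integrable_of_hasCompactSupport
        (hf.hasCompactSupport_pderiv j)) (by simpa using hf.integrable)
    (fun x _ => by fun_prop) (fun x _ => hf.differentiable x)
  simpa [pderiv] using h

theorem pderiv_norm_sq {f : Pt d → ℂ} (hf : IsTestFunction Ω f) (j : Fin d) (x : Pt d) :
    pderiv j (fun x => ‖f x‖ ^ 2) x = 2 * inner ℝ (f x) (pderiv j f x) := by
  rw [pderiv, ((hf.differentiable x).hasFDerivAt.norm_sq).fderiv]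
  simp [pderiv]
  ring

/-- Integration of `|f|²` by parts against the coordinate function `xⱼ`. -/
theorem integral_norm_sq_le {R : ℝ} (hR : 0 ≤ R) {f : Pt d → ℂ}
    (hf : IsTestFunction (Metric.ball 0 R) f) (j : Fin d) :
    ∫ x, ‖f x‖ ^ 2 ≤ 4 * R ^ 2 * ∫ x, ‖pderiv j f x‖ ^ 2 := by
  set e : Pt d := EuclideanSpace.single j 1
  have hd : ∀ x, fderiv ℝ (fun x => ‖f x‖ ^ 2) x e = 2 * inner ℝ (f x) (pderiv j f x) :=
    pderiv_norm_sq hf j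
  have hx : ∀ x : Pt d, fderiv ℝ (fun x : Pt d => x j) x e = 1 := fun x => by
    have h : HasFDerivAt (fun x : Pt d => x j) (EuclideanSpace.proj (𝕜 := ℝ) j) x :=
      (EuclideanSpace.proj (𝕜 := ℝ) j).hasFDerivAt
    rw [h.fderiv]
    simp [e]
  have i1 := integrable_norm_sq_of_hasCompactSupport hf.smooth.continuous hf.compact
  have i2 := integrable_norm_sq_of_hasCompactSupport (hf.continuous_pderiv j)
    (hf.hasCompactSupport_pderiv j)
  have hc := hf.smooth.continuous
  have hcp := hf.continuous_pderiv j
  have hcs : HasCompactSupport fun x => ‖f x‖ ^ 2 :=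
    hf.compact.comp_left (g := fun y => ‖y‖ ^ 2) (by simp)
  have hsupp : ∀ x, R < ‖x‖ → f x = 0 := fun x hxR =>
    image_eq_zero_of_notMem_tsupport fun h => by
      have := hf.support h
      rw [mem_ball_zero_iff] at this
      linarith
  have i3 : Integrable (fun x : Pt d => x j * (2 * inner ℝ (f x) (pderiv j f x))) volume := by
    refine Continuous.integrable_of_hasCompactSupport (by fun_prop) ?_
    refine hf.compact.mono fun x hx => ?_
    contrapose! hx
    simp [Function.notMem_support.1 hx]
  have ibp := integral_mul_fderiv_eq_neg_fderiv_mul_of_integrable (μ := volume)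
    (f := fun x : Pt d => x j) (g := fun x => ‖f x‖ ^ 2) (v := e)
    (by simpa only [hx, one_mul] using i1) (by simpa only [hd] using i3)
    (Continuous.integrable_of_hasCompactSupport (by fun_prop) hcs.mul_left)
    (fun x _ => by fun_prop) (fun x _ => (hf.differentiable x).norm_sq ℝ)
  simp only [hx, hd, one_mul] at ibp
  have hpt : ∀ x : Pt d, -(x j * (2 * inner ℝ (f x) (pderiv j f x))) ≤
      (1 / 2) * ‖f x‖ ^ 2 + (2 * R ^ 2) * ‖pderiv j f x‖ ^ 2 := fun x => by
    by_cases hxR : R < ‖x‖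
    · rw [hsupp x hxR]
      simp
      positivity
    · have h1 : |x j| ≤ R := (PiLp.norm_apply_le x j).trans (not_lt.1 hxR)
      have h2 := abs_real_inner_le_norm (f x) (pderiv j f x)
      have h3 : |x j * inner ℝ (f x) (pderiv j f x)| ≤ R * (‖f x‖ * ‖pderiv j f x‖) := by
        rw [abs_mul]
        gcongr
      have h4 := neg_abs_le (x j * inner ℝ (f x) (pderiv j f x))
      nlinarith [sq_nonneg (‖f x‖ - 2 * R * ‖pderiv j f x‖)]
  have hle : ∫ x, ‖f x‖ ^ 2 ≤ (1 / 2) * (∫ x, ‖f x‖ ^ 2) + (2 * R ^ 2) *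
      ∫ x, ‖pderiv j f x‖ ^ 2 := by
    calc ∫ x, ‖f x‖ ^ 2 = ∫ x : Pt d, -(x j * (2 * inner ℝ (f x) (pderiv j f x))) := by
          rw [integral_neg, ibp, neg_neg]
      _ ≤ ∫ x, ((1 / 2) * ‖f x‖ ^ 2 + (2 * R ^ 2) * ‖pderiv j f x‖ ^ 2) :=
          integral_mono i3.neg ((i1.const_mul _).add (i2.const_mul _)) hpt
      _ = _ := by
          rw [integral_add (i1.const_mul _) (i2.const_mul _), integral_const_mul,
            integral_const_mul]
  linarith

theorem norm_sq_fst_eq {z : FieldPair Ω} {u : Fin d → Pt d → ℂ}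
    (hu : ∀ i, IsTestFunction Ω (u i))
    (hz : ∀ᵐ x ∂(volume.restrict Ω), ∀ i, z.fst x i = u i x) :
    ‖z.fst‖ ^ 2 = ∑ i, ∫ x in Ω, ‖u i x‖ ^ 2 := by
  rw [norm_sq_eq_integral, ← integral_finsetSum]
  · refine integral_congr_ae ?_
    filter_upwards [hz] with x hx
    simp [EuclideanSpace.norm_sq_eq, hx]
  · exact fun i _ => (integrable_norm_sq_of_hasCompactSupport (hu i).smooth.continuous
      (hu i).compact).integrableOn

theorem norm_sq_snd_eq {z : FieldPair Ω} {u : Fin d → Pt d → ℂ}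
    (hu : ∀ i, IsTestFunction Ω (u i))
    (hz : ∀ᵐ x ∂(volume.restrict Ω), ∀ i j, z.snd x (i, j) = pderiv j (u i) x) :
    ‖z.snd‖ ^ 2 = ∑ i, ∑ j, ∫ x in Ω, ‖pderiv j (u i) x‖ ^ 2 := by
  rw [norm_sq_eq_integral, ← Fintype.sum_prod_type', ← integral_finsetSum]
  · refine integral_congr_ae ?_
    filter_upwards [hz] with x hx
    simp [EuclideanSpace.norm_sq_eq, hx, Fintype.sum_prod_type]
  · exact fun p _ => (integrable_norm_sq_of_hasCompactSupport ((hu p.1).continuous_pderiv p.2)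
      ((hu p.1).hasCompactSupport_pderiv p.2)).integrableOn

theorem norm_sq_H10 (v : H10 Ω) :
    ‖v‖ ^ 2 = ‖(v : FieldPair Ω).fst‖ ^ 2 + gradNorm v ^ 2 := by
  rw [Submodule.coe_norm, WithLp.prod_norm_sq_eq_of_L2]
  rfl

theorem exists_isPoincareConst (hd : 0 < d) (hΩ : Bornology.IsBounded Ω) :
    ∃ Cp : ℝ, IsPoincareConst Ω Cp := by
  obtain ⟨R, hR, hsub⟩ := hΩ.subset_ball_lt 0 (0 : Pt d)
  have key : ∀ v : H10 Ω, ‖(v : FieldPair Ω).fst‖ ^ 2 ≤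
      4 * R ^ 2 * ‖(v : FieldPair Ω).snd‖ ^ 2 := by
    intro v
    refine H10_induction (p := fun z => ‖z.fst‖ ^ 2 ≤ 4 * R ^ 2 * ‖z.snd‖ ^ 2) ?_ ?_ v
    · have h1 : Continuous fun z : FieldPair Ω => z.fst := (WithLp.fstL 2 ℂ _ _).continuous
      have h2 : Continuous fun z : FieldPair Ω => z.snd := (WithLp.sndL 2 ℂ _ _).continuous
      exact isClosed_le (by fun_prop) (by fun_prop)
    · rintro z ⟨u, hu, h1, h2⟩
      rw [norm_sq_fst_eq hu h1, norm_sq_snd_eq hu h2, Finset.mul_sum]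
      refine Finset.sum_le_sum fun i _ => ?_
      have h3 := integral_norm_sq_le hR.le ((hu i).mono hsub) ⟨0, hd⟩
      rw [(hu i).setIntegral_eq (g := fun y => ‖y‖ ^ 2) (by simp)]
      refine h3.trans ?_
      gcongr
      have h4 : ∫ x, ‖pderiv ⟨0, hd⟩ (u i) x‖ ^ 2 =
          ∫ x in Ω, ‖pderiv ⟨0, hd⟩ (u i) x‖ ^ 2 := by
        refine (setIntegral_eq_integral_of_forall_compl_eq_zero fun x hx => ?_).symm
        have : x ∉ tsupport (u i) := fun h => hx ((hu i).support h)
        rw [pderiv, image_eq_zero_of_notMem_tsupport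
          (fun h => this (tsupport_fderiv_subset ℝ h))]
        simp
      rw [h4]
      exact Finset.single_le_sum (f := fun j => ∫ x in Ω, ‖pderiv j (u i) x‖ ^ 2)
        (fun j _ => integral_nonneg fun x => by positivity) (Finset.mem_univ _)
  refine ⟨1 / (1 + 4 * R ^ 2), by positivity, fun v => ?_⟩
  rw [norm_sq_H10, div_mul_eq_mul_div, div_le_iff₀ (by positivity)]
  have := key v
  rw [gradNorm]
  linarith

end Spaces

/-! ### The divergence constant -/

section DivConst

variable {d : ℕ} {Ω : Set (Pt d)}

theorem mem_L20_iff [IsFiniteMeasure (volume.restrict Ω)] (q : Lp ℂ 2 (volume.restrict Ω)) :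
    q ∈ L20 Ω ↔ ∫ x in Ω, q x = 0 :=
  ⟨fun h => h.2, fun h => ⟨(Lp.memLp q).integrable (by norm_num), h⟩⟩

theorem isClosed_L20 [IsFiniteMeasure (volume.restrict Ω)] :
    IsClosed (L20 Ω : Set (Lp ℂ 2 (volume.restrict Ω))) := by
  have h : (L20 Ω : Set (Lp ℂ 2 (volume.restrict Ω))) = {q | inner ℂ (indicatorConstLp 2
      MeasurableSet.univ (measure_ne_top (volume.restrict Ω) _) (1 : ℂ)) q = 0} := by
    ext q
    rw [Set.mem_ofPred_eq, L2.inner_indicatorConstLp_one, SetLike.mem_coe, mem_L20_iff,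
      Measure.restrict_univ]
  rw [h]
  exact isClosed_eq (by fun_prop) continuous_const

/-- The trace of a complex matrix. -/
def matTrace (d : ℕ) : EuclideanSpace ℂ (Fin d × Fin d) →L[ℂ] ℂ :=
  ∑ i, EuclideanSpace.proj (i, i)

/-- The divergence on pairs `(v, ∇v)`: the trace of the second component. -/
def divPair (Ω : Set (Pt d)) : FieldPair Ω →L[ℂ] Lp ℂ 2 (volume.restrict Ω) :=
  (matTrace d).compLpL 2 (volume.restrict Ω) ∘L WithLp.sndL 2 ℂ (L2Vec Ω) (L2Mat Ω)

theorem coeFn_divPair (z : FieldPair Ω) :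
    ∀ᵐ x ∂(volume.restrict Ω), divPair Ω z x = ∑ i, z.snd x (i, i) := by
  filter_upwards [(matTrace d).coeFn_compLpL (p := 2) (z.snd)] with x hx
  refine hx.trans ?_
  simp [matTrace]

theorem divPair_mem_L20 [IsFiniteMeasure (volume.restrict Ω)] (v : H10 Ω) :
    divPair Ω v ∈ L20 Ω := by
  refine H10_induction (p := fun z => divPair Ω z ∈ L20 Ω) ?_ ?_ v
  · exact isClosed_L20.preimage (divPair Ω).continuous
  · rintro z ⟨u, hu, -, h2⟩
    rw [mem_L20_iff]
    have : ∫ x in Ω, divPair Ω z x = ∫ x in Ω, ∑ i, pderiv i (u i) x := by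
      refine integral_congr_ae ?_
      filter_upwards [coeFn_divPair z, h2] with x hx hx2
      rw [hx]
      simp [hx2]
    have hi : ∀ i, Integrable (pderiv i (u i)) volume := fun i =>
      ((hu i).continuous_pderiv i).integrable_of_hasCompactSupport
        ((hu i).hasCompactSupport_pderiv i)
    rw [this, integral_finsetSum _ fun i _ => (hi i).integrableOn]
    refine Finset.sum_eq_zero fun i _ => ?_
    rw [setIntegral_eq_integral_of_forall_compl_eq_zero, integral_pderiv_eq_zero (hu i)]
    intro x hx
    have : x ∉ tsupport (u i) := fun h => hx ((hu i).support h)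
    rw [pderiv, image_eq_zero_of_notMem_tsupport (fun h => this (tsupport_fderiv_subset ℝ h))]
    simp

/-- The divergence as an operator from `H¹₀(Ω, ℂ)ᵈ` to `L²₀(Ω, ℂ)`. -/
def divOp (Ω : Set (Pt d)) [IsFiniteMeasure (volume.restrict Ω)] : H10 Ω →L[ℂ] L20 Ω :=
  (divPair Ω ∘L (H10 Ω).subtypeL).codRestrict (L20 Ω) divPair_mem_L20

theorem coeFn_divOp [IsFiniteMeasure (volume.restrict Ω)] (v : H10 Ω) :
    ∀ᵐ x ∂(volume.restrict Ω), (divOp Ω v : Lp ℂ 2 (volume.restrict Ω)) x = divg v x :=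
  coeFn_divPair _

/-- The elements of `L²₀` that have a representative in `C_c^∞(Ω)`. -/
def meanZeroTests (Ω : Set (Pt d)) : Submodule ℂ (L20 Ω) where
  carrier := {q | ∃ f : Pt d → ℂ, IsTestFunction Ω f ∧
    ∀ᵐ x ∂(volume.restrict Ω), (q : Lp ℂ 2 (volume.restrict Ω)) x = f x}
  add_mem' := by
    rintro p q ⟨f, hf, hp⟩ ⟨g, hg, hq⟩
    refine ⟨_, hf.add hg, ?_⟩
    filter_upwards [hp, hq, Lp.coeFn_add (p : Lp ℂ 2 (volume.restrict Ω)) q] with x h1 h2 h3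
    rw [Submodule.coe_add, h3, Pi.add_apply, h1, h2]
  zero_mem' := by
    refine ⟨_, isTestFunction_zero, ?_⟩
    filter_upwards [Lp.coeFn_zero ℂ 2 (volume.restrict Ω)] with x h
    rw [Submodule.coe_zero, h, Pi.zero_apply]
  smul_mem' := by
    rintro c q ⟨f, hf, hq⟩
    refine ⟨_, hf.const_mul c, ?_⟩
    filter_upwards [hq, Lp.coeFn_smul c (q : Lp ℂ 2 (volume.restrict Ω))] with x h1 h2
    rw [Submodule.coe_smul, h2, Pi.smul_apply, h1, smul_eq_mul]

theorem exists_mem_meanZeroTests [IsFiniteMeasure (volume.restrict Ω)] {f : Pt d → ℂ}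
    (hf : IsTestFunction Ω f) (hf0 : ∫ x, f x = 0) :
    ∃ q ∈ meanZeroTests Ω,
      ∀ᵐ x ∂(volume.restrict Ω), (q : Lp ℂ 2 (volume.restrict Ω)) x = f x := by
  have h1 : MemLp f 2 (volume.restrict Ω) :=
    (hf.smooth.continuous.memLp_of_hasCompactSupport hf.compact).restrict Ω
  have h2 : h1.toLp f ∈ L20 Ω := by
    rw [mem_L20_iff, integral_congr_ae h1.coeFn_toLp, hf.setIntegral]
    exact hf0
  exact ⟨⟨h1.toLp f, h2⟩, ⟨f, hf, h1.coeFn_toLp⟩, h1.coeFn_toLp⟩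

/-- A function that is orthogonal to all test functions of mass zero is constant: it is orthogonal
to `g - (∫ g) η₀` for every test function `g`, where `η₀` is a fixed bump of mass one. -/
theorem ae_eq_const_of_orthogonal (hΩ : IsLipschitzPolyhedralDomain Ω) {P : Pt d → ℂ}
    (hP : Integrable P (volume.restrict Ω))
    (h : ∀ f, IsTestFunction Ω f → ∫ x, f x = 0 → ∫ x in Ω, conj (f x) * P x = 0) :
    ∃ κ : ℂ, ∀ᵐ x ∂(volume.restrict Ω), P x = κ := by
  have : IsFiniteMeasure (volume.restrict Ω) := ⟨by simpa using hΩ.isBounded.measure_lt_top⟩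
  obtain ⟨x₀, hx₀⟩ := hΩ.isConnected.nonempty
  obtain ⟨r, hr, hball⟩ := Metric.isOpen_iff.1 hΩ.isOpen x₀ hx₀
  obtain ⟨η₀, hη₀, hη₀1⟩ := exists_bump x₀ (half_pos hr)
  have hη := hη₀.mono ((Metric.closedBall_subset_ball (half_lt_self hr)).trans hball)
  have hfP : ∀ f, IsTestFunction Ω f → Integrable (fun x => conj (f x) * P x)
      (volume.restrict Ω) := fun f hf => by
    obtain ⟨M, hM⟩ := hf.smooth.continuous.bounded_above_of_compact_support hf.compact
    refine hP.bdd_mul (c := M) ?_ (Filter.Eventually.of_forall fun x => ?_)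
    · have := hf.smooth.continuous
      exact Continuous.aestronglyMeasurable (by fun_prop)
    · simpa using hM x
  set κ := ∫ x in Ω, conj (η₀ x) * P x
  refine ⟨κ, ?_⟩
  have hconst : ∀ᵐ x, x ∈ Ω → P x - κ = 0 := by
    refine hΩ.isOpen.ae_eq_zero_of_integral_contDiff_smul_eq_zero ?_ ?_
    · have hi : IntegrableOn (fun x => P x - κ) Ω volume := hP.sub (integrable_const κ)
      exact hi.locallyIntegrableOn
    · intro g hg hgc hgs
      have hgt : IsTestFunction Ω fun x => (g x : ℂ) := by
        refine ⟨Complex.ofRealCLM.contDiff.comp hg,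
          hgc.comp_left (g := fun r : ℝ => (r : ℂ)) (by simp), ?_⟩
        exact (closure_mono fun x hx => by simpa using hx).trans hgs
      have hgP : Integrable (fun x => (g x : ℂ) * P x) (volume.restrict Ω) := by
        simpa using hfP _ hgt
      set m := ∫ x, g x
      have hm : ∫ x, (g x : ℂ) = m := integral_complex_ofReal
      have h1 := h _ (hgt.sub (hη.const_mul (m : ℂ))) (by
        rw [integral_sub hgt.integrable (hη.const_mul _).integrable, integral_const_mul, hη₀1, hm]
        simp)
      have h2 : ∫ x in Ω, conj ((g x : ℂ) - m * η₀ x) * P x =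
          (∫ x in Ω, (g x : ℂ) * P x) - m * κ := by
        rw [← integral_const_mul, ← integral_sub hgP ((hfP _ hη).const_mul _)]
        refine integral_congr_ae (Filter.Eventually.of_forall fun x => ?_)
        simp only [map_sub, map_mul, Complex.conj_ofReal]
        ring
      have h3 : ∫ x, g x • (P x - κ) = ∫ x in Ω, ((g x : ℂ) * P x - (g x : ℂ) * κ) := by
        rw [← setIntegral_eq_integral_of_forall_compl_eq_zero (s := Ω)]
        · refine integral_congr_ae (Filter.Eventually.of_forall fun x => ?_)
          simp only [Complex.real_smul]
          ring
        · intro x hx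
          rw [image_eq_zero_of_notMem_tsupport fun h => hx (hgs h), zero_smul]
      rw [h3, integral_sub hgP (hgt.integrable.integrableOn.mul_const _),
        integral_mul_const, hgt.setIntegral, hm, ← h2, h1]
  rw [ae_restrict_iff' hΩ.isOpen.measurableSet]
  filter_upwards [hconst] with x hx hxΩ
  exact sub_eq_zero.1 (hx hxΩ)

theorem dense_meanZeroTests (hΩ : IsLipschitzPolyhedralDomain Ω)
    [IsFiniteMeasure (volume.restrict Ω)] :
    (meanZeroTests Ω).topologicalClosure = ⊤ := by
  have : CompleteSpace (L20 Ω) := isClosed_L20.completeSpace_coe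
  rw [Submodule.topologicalClosure_eq_top_iff, Submodule.eq_bot_iff]
  intro p hp
  obtain ⟨κ, hκ⟩ := ae_eq_const_of_orthogonal hΩ p.2.1 fun f hf hf0 => by
    obtain ⟨q, hq, hqf⟩ := exists_mem_meanZeroTests hf hf0
    have horth : inner ℂ q p = 0 := (Submodule.mem_orthogonal _ p).1 hp q hq
    rw [← horth, Submodule.coe_inner, L2.inner_def]
    refine integral_congr_ae ?_
    filter_upwards [hqf] with x hx
    rw [hx, RCLike.inner_apply, mul_comm]
  have hvol : (volume.restrict Ω).real Set.univ ≠ 0 := by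
    rw [measureReal_def, Measure.restrict_apply_univ, ENNReal.toReal_ne_zero]
    exact ⟨(hΩ.isOpen.measure_pos volume hΩ.isConnected.nonempty).ne',
      hΩ.isBounded.measure_lt_top.ne⟩
  have hκ0 : κ = 0 := by
    have h := p.2.2
    rw [integral_congr_ae hκ, integral_const, smul_eq_zero] at h
    exact h.resolve_left hvol
  refine Subtype.ext ((Lp.eq_zero_iff_ae_eq_zero).2 ?_)
  filter_upwards [hκ] with x hx
  rw [Pi.zero_apply, ← hκ0, ← hx]

/-- The divergence maps `H¹₀` onto `L²₀`, with a bounded right inverse. -/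
theorem exists_isDivConst (hd : 0 < d) (hΩ : IsLipschitzPolyhedralDomain Ω) :
    ∃ C : ℝ, IsDivConst Ω C := by
  have : IsFiniteMeasure (volume.restrict Ω) := ⟨by simpa using hΩ.isBounded.measure_lt_top⟩
  have : CompleteSpace (H10 Ω) := (Submodule.isClosed_topologicalClosure _).completeSpace_coe
  obtain ⟨Cp, hCp, hP⟩ := exists_isPoincareConst hd hΩ.isBounded
  obtain ⟨C, hC, hsolve⟩ := exists_field_of_integral_eq_zero hΩ
  set C' := √(d ^ 2 * C / Cp) with hC'
  have hC'0 : 0 < C' := Real.sqrt_pos.2 (by positivity)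
  set D : NormedAddGroupHom (H10 Ω) (L20 Ω) :=
    (divOp Ω).toAddMonoidHom.mkNormedAddGroupHom ‖divOp Ω‖ (divOp Ω).le_opNorm
  have hsurj : D.SurjectiveOnWith (meanZeroTests Ω).toAddSubgroup C' := by
    rintro q ⟨f, hf, hqf⟩
    have hf0 : ∫ x, f x = 0 := by
      rw [← hf.setIntegral, ← q.2.2]
      exact (integral_congr_ae hqf).symm
    obtain ⟨u, hu, hdiv, hb⟩ := hsolve f hf hf0
    obtain ⟨z, hz, -, h2⟩ := exists_mem_testFields hu
    set v : H10 Ω := ⟨z, testFields_le_H10 hz⟩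
    have hDv : divOp Ω v = q := by
      refine Subtype.ext (Lp.ext ?_)
      filter_upwards [coeFn_divOp v, h2, hqf] with x h3 h4 h5
      rw [h3, h5, ← hdiv x]
      exact Finset.sum_congr rfl fun i _ => h4 i i
    refine ⟨v, hDv, ?_⟩
    have hq : ‖q‖ ^ 2 = ∫ x, ‖f x‖ ^ 2 := by
      rw [Submodule.coe_norm, norm_sq_eq_integral,
        ← hf.setIntegral_eq (g := fun y => ‖y‖ ^ 2) (by simp)]
      refine integral_congr_ae ?_
      filter_upwards [hqf] with x hx
      rw [hx]
    have hg : gradNorm v ^ 2 ≤ d ^ 2 * C * ‖q‖ ^ 2 := by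
      rw [hq]
      calc gradNorm v ^ 2 = ∑ i, ∑ j, ∫ x in Ω, ‖pderiv j (u i) x‖ ^ 2 := norm_sq_snd_eq hu h2
        _ ≤ ∑ _i : Fin d, ∑ _j : Fin d, C * ∫ x, ‖f x‖ ^ 2 :=
          Finset.sum_le_sum fun i _ => Finset.sum_le_sum fun j _ => hb i j
        _ = _ := by simp; ring
    have hv : ‖v‖ ^ 2 ≤ (C' * ‖q‖) ^ 2 := by
      rw [mul_pow, hC', Real.sq_sqrt (by positivity), div_mul_eq_mul_div, le_div_iff₀ hCp]
      linarith [hP v]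
    exact le_of_sq_le_sq hv (by positivity)
  have hall := controlled_closure_of_complete hC'0 one_pos hsurj
  refine ⟨C' + 1, by positivity, fun q => ?_⟩
  have hmem : -q ∈ (meanZeroTests Ω).toAddSubgroup.topologicalClosure := by
    have : -q ∈ (meanZeroTests Ω).topologicalClosure := by
      rw [dense_meanZeroTests hΩ]
      trivial
    exact this
  obtain ⟨v, hv, hn⟩ := hall (-q) hmem
  refine ⟨v, by simpa using hn, ?_⟩
  have hv' : divOp Ω v = -q := hv
  filter_upwards [coeFn_divOp v, Lp.coeFn_neg (q : Lp ℂ 2 (volume.restrict Ω))] with x h1 h2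
  rw [← h1, hv', Submodule.coe_neg, h2, Pi.neg_apply]

end DivConst

/-! ### Operators on Hilbert spaces -/

section PointwiseOperator

variable {α E F : Type*} [MeasurableSpace α] [NormedAddCommGroup E] [NormedSpace ℂ E]
  [NormedAddCommGroup F] [NormedSpace ℂ F] {μ : Measure α}

/-- A bounded measurable family of linear maps acts on `L²`. -/
theorem exists_pointwise_operator (m : α → E →ₗ[ℂ] F) {c : ℝ}
    (hmeas : ∀ f : α → E, AEStronglyMeasurable f μ → AEStronglyMeasurable (fun x => m x (f x)) μ)
    (hb : ∀ᵐ x ∂μ, ∀ e, ‖m x e‖ ≤ c * ‖e‖) :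
    ∃ T : Lp E 2 μ →L[ℂ] Lp F 2 μ, (∀ f, ∀ᵐ x ∂μ, T f x = m x (f x)) ∧
      ∀ f, ‖T f‖ ≤ c * ‖f‖ := by
  have hle : ∀ f : Lp E 2 μ, ∀ᵐ x ∂μ, ‖m x (f x)‖ ≤ c * ‖f x‖ := fun f => by
    filter_upwards [hb] with x hx
    exact hx _
  have hmem : ∀ f : Lp E 2 μ, MemLp (fun x => m x (f x)) 2 μ := fun f =>
    (Lp.memLp f).of_le_mul (hmeas f (Lp.aestronglyMeasurable f)) (hle f)
  let T₀ : Lp E 2 μ →ₗ[ℂ] Lp F 2 μ :=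
    { toFun := fun f => (hmem f).toLp _
      map_add' := fun f g => by
        refine Lp.ext ?_
        filter_upwards [(hmem (f + g)).coeFn_toLp, (hmem f).coeFn_toLp, (hmem g).coeFn_toLp,
          Lp.coeFn_add f g, Lp.coeFn_add ((hmem f).toLp _) ((hmem g).toLp _)] with x h1 h2 h3 h4 h5
        rw [h1, h5, Pi.add_apply, h2, h3, h4, Pi.add_apply, map_add]
      map_smul' := fun a f => by
        refine Lp.ext ?_
        filter_upwards [(hmem (a • f)).coeFn_toLp, (hmem f).coeFn_toLp, Lp.coeFn_smul a f,
          Lp.coeFn_smul a ((hmem f).toLp _)] with x h1 h2 h3 h4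
        rw [h1, RingHom.id_apply, h4, Pi.smul_apply, h2, h3, Pi.smul_apply, map_smul] }
  have hT₀ : ∀ f, ‖T₀ f‖ ≤ c * ‖f‖ := fun f => by
    refine Lp.norm_le_mul_norm_of_ae_le_mul ?_
    filter_upwards [(hmem f).coeFn_toLp, hle f] with x h1 h2
    exact (congrArg norm h1).trans_le h2
  exact ⟨T₀.mkContinuous c hT₀, fun f => (hmem f).coeFn_toLp, hT₀⟩

end PointwiseOperator

section InfSup

variable {X' : Type*} [NormedAddCommGroup X'] [InnerProductSpace ℂ X']

theorem iSup_norm_inner_div [Nontrivial X'] (w : X') {c : ℝ} (hc : 0 < c) :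
    ⨆ z : {z : X' // z ≠ 0}, ENNReal.ofReal (‖inner ℂ z.1 w‖ / (c * ‖z.1‖)) =
      ENNReal.ofReal (‖w‖ / c) := by
  refine le_antisymm (iSup_le fun z => ENNReal.ofReal_le_ofReal ?_) ?_
  · have hz : 0 < ‖z.1‖ := norm_pos_iff.2 z.2
    rw [div_le_div_iff₀ (by positivity) hc]
    have := norm_inner_le_norm (𝕜 := ℂ) z.1 w
    calc _ ≤ ‖z.1‖ * ‖w‖ * c := by gcongr
      _ = _ := by ring
  · by_cases hw : w = 0
    · simp [hw]
    · refine le_iSup_of_le ⟨w, hw⟩ (ENNReal.ofReal_le_ofReal (le_of_eq ?_))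
      have hw' : ‖w‖ ≠ 0 := norm_ne_zero_iff.2 hw
      have : ‖inner ℂ w w‖ = ‖w‖ ^ 2 := by
        rw [inner_self_eq_norm_sq_to_K, norm_pow]
        simp
      simp only [this]
      field_simp

/-- The least dilation of an invertible operator is the reciprocal of the norm of its inverse. -/
theorem iInf_norm_div_eq [Nontrivial X'] {T S : X' →L[ℂ] X'} (hTS : ∀ x, T (S x) = x)
    (hST : ∀ x, S (T x) = x) :
    ⨅ y : {y : X' // y ≠ 0}, ENNReal.ofReal (‖T y.1‖ / ‖y.1‖) = ENNReal.ofReal (1 / ‖S‖) := by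
  obtain ⟨x₀, hx₀⟩ := exists_ne (0 : X')
  have hS : 0 < ‖S‖ := norm_pos_iff.2 fun h => hx₀ (by rw [← hTS x₀, h]; simp)
  refine le_antisymm ?_ (le_iInf fun y => ENNReal.ofReal_le_ofReal ?_)
  · set b := ⨅ y : {y : X' // y ≠ 0}, ENNReal.ofReal (‖T y.1‖ / ‖y.1‖) with hb
    have hbt : b ≠ ⊤ := ne_top_of_le_ne_top ENNReal.ofReal_ne_top (iInf_le _ ⟨x₀, hx₀⟩)
    have hle : ∀ y : X', b.toReal * ‖y‖ ≤ ‖T y‖ := fun y => by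
      by_cases hy : y = 0
      · simp [hy]
      · have h1 : b ≤ ENNReal.ofReal (‖T y‖ / ‖y‖) := iInf_le _ (⟨y, hy⟩ : {y : X' // y ≠ 0})
        have h2 := ENNReal.toReal_mono ENNReal.ofReal_ne_top h1
        rw [ENNReal.toReal_ofReal (by positivity)] at h2
        exact (le_div_iff₀ (norm_pos_iff.2 hy)).1 h2
    rw [← ENNReal.ofReal_toReal hbt]
    refine ENNReal.ofReal_le_ofReal ?_
    rw [le_div_iff₀ hS]
    rcases eq_or_lt_of_le (ENNReal.toReal_nonneg (a := b)) with h0 | h0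
    · rw [← h0]
      simp
    · have : ‖S‖ ≤ 1 / b.toReal := S.opNorm_le_bound (by positivity) fun x => by
        have := hle (S x)
        rw [hTS] at this
        rw [div_mul_eq_mul_div, one_mul, le_div_iff₀ h0]
        linarith
      rw [le_div_iff₀ h0] at this
      linarith
  · have hy : 0 < ‖y.1‖ := norm_pos_iff.2 y.2
    rw [div_le_div_iff₀ hS hy, one_mul]
    have := S.le_opNorm (T y.1)
    rw [hST] at this
    linarith

variable [CompleteSpace X']

/-- An operator that is bounded below and has dense range is invertible. -/
theorem exists_inverse_of_le_norm {T : X' →L[ℂ] X'} {K : ℝ} (hK : 0 < K)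
    (hT : ∀ y, ‖y‖ ≤ K * ‖T y‖) (hdense : ∀ z, (∀ y, inner ℂ z (T y) = 0) → z = 0) :
    ∃ S : X' →L[ℂ] X', (∀ x, T (S x) = x) ∧ (∀ x, S (T x) = x) ∧ ‖S‖ ≤ K := by
  have hinj : T.ker = ⊥ := LinearMap.ker_eq_bot'.2 fun y hy => by
    have h := hT y
    have hy' : T y = 0 := hy
    rw [hy', norm_zero, mul_zero] at h
    exact norm_le_zero_iff.1 h
  have hanti : AntilipschitzWith ⟨K, hK.le⟩ T := T.antilipschitz_of_bound hT
  have hclosed : IsClosed (T.range : Set X') := by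
    have h : IsClosed (Set.range T) := hanti.isClosed_range T.uniformContinuous
    exact h
  have hrange : T.range = ⊤ := by
    rw [← hclosed.submodule_topologicalClosure_eq, Submodule.topologicalClosure_eq_top_iff,
      Submodule.eq_bot_iff]
    intro z hz
    refine hdense z fun y => ?_
    exact (Submodule.mem_orthogonal' _ z).1 hz (T y) ⟨y, rfl⟩
  let e := ContinuousLinearEquiv.ofBijective T hinj hrange
  have he : ∀ x, e x = T x := fun x => rfl
  refine ⟨e.symm, fun x => ?_, fun x => ?_, ?_⟩
  · exact e.apply_symm_apply x
  · exact e.symm_apply_apply x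
  · refine ContinuousLinearMap.opNorm_le_bound _ hK.le fun x => ?_
    have h := hT (e.symm x)
    have h2 : T (e.symm x) = x := e.apply_symm_apply x
    rwa [h2] at h

end InfSup

section Saddle

variable {H Q : Type*} [NormedAddCommGroup H] [InnerProductSpace ℂ H] [CompleteSpace H]
  [NormedAddCommGroup Q] [InnerProductSpace ℂ Q] [CompleteSpace Q]

/-- The operator `(u, p) ↦ (𝒜 u - D† p, D u)` of a saddle point problem. -/
def saddleOp (𝒜 : H →L[ℂ] H) (D : H →L[ℂ] Q) : WithLp 2 (H × Q) →L[ℂ] WithLp 2 (H × Q) :=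
  (WithLp.prodContinuousLinearEquiv 2 ℂ H Q).symm.toContinuousLinearMap ∘L
    ((𝒜 ∘L WithLp.fstL 2 ℂ H Q - D.adjoint ∘L WithLp.sndL 2 ℂ H Q).prod
      (D ∘L WithLp.fstL 2 ℂ H Q))

theorem inner_saddleOp (𝒜 : H →L[ℂ] H) (D : H →L[ℂ] Q) (y z : WithLp 2 (H × Q)) :
    inner ℂ z (saddleOp 𝒜 D y) =
      inner ℂ z.fst (𝒜 y.fst) - inner ℂ (D z.fst) y.snd + inner ℂ z.snd (D y.fst) := by
  have : inner ℂ z (saddleOp 𝒜 D y) = inner ℂ z.fst (𝒜 y.fst - D.adjoint y.snd) +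
      inner ℂ z.snd (D y.fst) := WithLp.prod_inner_apply _ _
  rw [this, inner_sub_right, ContinuousLinearMap.adjoint_inner_right]

/-- The operator that represents the form `ν ⟪G v, G u⟫ + ⟪V v, M G u⟫`. -/
def formOp {E F : Type*} [NormedAddCommGroup E] [InnerProductSpace ℂ E] [CompleteSpace E]
    [NormedAddCommGroup F] [InnerProductSpace ℂ F] [CompleteSpace F] (ν : ℂ) (V : H →L[ℂ] E)
    (G : H →L[ℂ] F) (M : F →L[ℂ] E) : H →L[ℂ] H :=
  ν • (G.adjoint ∘L G) + V.adjoint ∘L M ∘L G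

theorem inner_formOp {E F : Type*} [NormedAddCommGroup E] [InnerProductSpace ℂ E]
    [CompleteSpace E] [NormedAddCommGroup F] [InnerProductSpace ℂ F] [CompleteSpace F] (ν : ℂ)
    (V : H →L[ℂ] E) (G : H →L[ℂ] F) (M : F →L[ℂ] E) (u v : H) :
    inner ℂ v (formOp ν V G M u) = ν * inner ℂ (G v) (G u) + inner ℂ (V v) (M (G u)) := by
  have h1 : inner ℂ v (G.adjoint (G u)) = inner ℂ (G v) (G u) :=
    ContinuousLinearMap.adjoint_inner_right _ _ _
  have h2 : inner ℂ v (V.adjoint (M (G u))) = inner ℂ (V v) (M (G u)) :=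
    ContinuousLinearMap.adjoint_inner_right _ _ _
  have h3 : formOp ν V G M u = ν • G.adjoint (G u) + V.adjoint (M (G u)) := rfl
  rw [h3, inner_add_right, inner_smul_right, h1, h2]

variable {𝒜 : H →L[ℂ] H} {D : H →L[ℂ] Q} {g : H → ℝ} {ν B Cp C : ℝ}

/-- The a priori estimate. Testing with `(u, p)` bounds the energy `ν g(u)²`; testing with a
right inverse of the divergence at `p` bounds the pressure by the energy. -/
theorem norm_sq_le_saddleOp (hν : 0 < ν) (hB : 0 ≤ B) (hCp : 0 < Cp) (hC : 0 < C)
    (hg : ∀ u, 0 ≤ g u) (h1 : ∀ u, (inner ℂ u (𝒜 u)).re = ν * g u ^ 2)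
    (h2 : ∀ u, Cp * ‖u‖ ^ 2 ≤ g u ^ 2)
    (h3 : ∀ u v, ‖inner ℂ v (𝒜 u)‖ ≤ (ν + B) * g u * ‖v‖)
    (h4 : ∀ q, ∃ v, ‖v‖ ≤ C * ‖q‖ ∧ D v = -q) (y : WithLp 2 (H × Q)) :
    ‖y‖ ^ 2 ≤ (2 / (ν ^ 2 * Cp ^ 2) + 4 * C ^ 2 + 8 * C ^ 4 * ((ν + B) ^ 2 / ν) ^ 2) *
      ‖saddleOp 𝒜 D y‖ ^ 2 := by
  set u := y.fst with hu
  set p := y.snd with hp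
  set F := ‖saddleOp 𝒜 D y‖ with hF
  set Y := ‖y‖ with hY
  have hF0 : 0 ≤ F := norm_nonneg _
  have hY0 : 0 ≤ Y := norm_nonneg _
  have hY2 : Y ^ 2 = ‖u‖ ^ 2 + ‖p‖ ^ 2 := WithLp.prod_norm_sq_eq_of_L2 y
  have hg0 := hg u
  have henergy : ν * g u ^ 2 ≤ F * Y := by
    have e : (inner ℂ y (saddleOp 𝒜 D y)).re = ν * g u ^ 2 := by
      have hsym : (inner ℂ (D u) p).re = (inner ℂ p (D u)).re := by
        rw [← inner_conj_symm, Complex.conj_re]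
      rw [inner_saddleOp, Complex.add_re, Complex.sub_re, h1, hsym]
      ring
    rw [← e, mul_comm]
    exact (Complex.re_le_norm _).trans (norm_inner_le_norm _ _)
  have hpress : ‖p‖ ≤ C * (F + (ν + B) * g u) := by
    obtain ⟨v, hv, hDv⟩ := h4 p
    have e : inner ℂ (WithLp.toLp 2 (v, (0 : Q))) (saddleOp 𝒜 D y) =
        inner ℂ v (𝒜 u) + ((‖p‖ ^ 2 : ℝ) : ℂ) := by
      rw [inner_saddleOp]
      simp [hDv, hu, hp, inner_self_eq_norm_sq_to_K]
    have hnv : ‖(WithLp.toLp 2 (v, (0 : Q)) : WithLp 2 (H × Q))‖ = ‖v‖ := by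
      rw [← sq_eq_sq₀ (norm_nonneg _) (norm_nonneg _), WithLp.prod_norm_sq_eq_of_L2]
      simp
    have h5 : ‖p‖ ^ 2 ≤ ‖v‖ * F + (ν + B) * g u * ‖v‖ := by
      have e2 : ((‖p‖ ^ 2 : ℝ) : ℂ) = inner ℂ (WithLp.toLp 2 (v, (0 : Q))) (saddleOp 𝒜 D y) -
          inner ℂ v (𝒜 u) := by rw [e]; ring
      calc ‖p‖ ^ 2 = ‖((‖p‖ ^ 2 : ℝ) : ℂ)‖ := by
            rw [Complex.norm_real, Real.norm_of_nonneg (by positivity)]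
        _ ≤ _ := by
            rw [e2]
            refine (norm_sub_le _ _).trans (add_le_add ?_ (h3 u v))
            exact (norm_inner_le_norm _ _).trans_eq (by rw [hnv])
    have h6 : ‖p‖ ^ 2 ≤ ‖p‖ * (C * (F + (ν + B) * g u)) := by
      calc ‖p‖ ^ 2 ≤ ‖v‖ * (F + (ν + B) * g u) := by linarith
        _ ≤ (C * ‖p‖) * (F + (ν + B) * g u) := by gcongr
        _ = _ := by ring
    rcases eq_or_lt_of_le (norm_nonneg p) with h0 | h0
    · rw [← h0]
      positivity
    · rw [sq] at h6
      exact le_of_mul_le_mul_left h6 h0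
  set S := (ν + B) ^ 2 / ν with hS
  have hS0 : 0 ≤ S := by positivity
  have hp2 : ‖p‖ ^ 2 ≤ 2 * C ^ 2 * F ^ 2 + 2 * C ^ 2 * S * (F * Y) := by
    have e : (ν + B) ^ 2 * g u ^ 2 = S * (ν * g u ^ 2) := by
      rw [hS]
      field_simp
    calc ‖p‖ ^ 2 ≤ (C * (F + (ν + B) * g u)) ^ 2 := by gcongr
      _ ≤ C ^ 2 * (2 * (F ^ 2 + ((ν + B) * g u) ^ 2)) := by
        rw [mul_pow]
        gcongr
        exact add_sq_le
      _ = 2 * C ^ 2 * F ^ 2 + 2 * C ^ 2 * (S * (ν * g u ^ 2)) := by rw [← e]; ring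
      _ ≤ 2 * C ^ 2 * F ^ 2 + 2 * C ^ 2 * (S * (F * Y)) := by gcongr
      _ = _ := by ring
  have hu2 : ‖u‖ ^ 2 ≤ 1 / (ν * Cp) * (F * Y) := by
    rw [div_mul_eq_mul_div, one_mul, le_div_iff₀ (by positivity)]
    have := mul_le_mul_of_nonneg_left (h2 u) hν.le
    linarith
  set κ := 1 / (ν * Cp) + 2 * C ^ 2 * S with hκ
  have h7 : Y ^ 2 ≤ 4 * C ^ 2 * F ^ 2 + κ ^ 2 * F ^ 2 := by
    have : Y ^ 2 ≤ 2 * C ^ 2 * F ^ 2 + κ * F * Y := by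
      rw [hY2, hκ]
      linarith
    nlinarith [sq_nonneg (κ * F - Y)]
  have h8 : κ ^ 2 ≤ 2 / (ν ^ 2 * Cp ^ 2) + 8 * C ^ 4 * S ^ 2 := by
    refine (add_sq_le (a := 1 / (ν * Cp)) (b := 2 * C ^ 2 * S)).trans_eq ?_
    field_simp
    ring
  have h9 := mul_le_mul_of_nonneg_right h8 (sq_nonneg F)
  linarith

theorem eq_zero_of_inner_saddleOp_eq_zero (hν : 0 < ν) (hCp : 0 < Cp)
    (h1 : ∀ u, (inner ℂ u (𝒜 u)).re = ν * g u ^ 2)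
    (h2 : ∀ u, Cp * ‖u‖ ^ 2 ≤ g u ^ 2) (h4 : ∀ q, ∃ v, D v = -q) (z : WithLp 2 (H × Q))
    (hz : ∀ y, inner ℂ z (saddleOp 𝒜 D y) = 0) : z = 0 := by
  have hu : z.fst = 0 := by
    have e := congrArg Complex.re (hz z)
    have hsym : (inner ℂ (D z.fst) z.snd).re = (inner ℂ z.snd (D z.fst)).re := by
      rw [← inner_conj_symm, Complex.conj_re]
    rw [inner_saddleOp, Complex.add_re, Complex.sub_re, h1, hsym, Complex.zero_re] at e
    have e' : ν * g z.fst ^ 2 = 0 := by linarith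
    have hg : g z.fst ^ 2 = 0 := (mul_eq_zero.1 e').resolve_left hν.ne'
    have h := h2 z.fst
    rw [hg] at h
    have h' : ‖z.fst‖ ^ 2 ≤ 0 := by
      by_contra! hlt
      nlinarith
    exact norm_eq_zero.1 (pow_eq_zero_iff two_ne_zero |>.1 (le_antisymm h' (sq_nonneg _)))
  have hp : z.snd = 0 := by
    obtain ⟨v, hv⟩ := h4 z.snd
    have e := hz (WithLp.toLp 2 (v, (0 : Q)))
    rw [inner_saddleOp] at e
    simpa [hu, hv] using e
  exact WithLp.ofLp_injective 2 (Prod.ext hu hp)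

end Saddle

/-! ### The forms as operators -/

section Convection

variable {d : ℕ} {Ω : Set (Pt d)} {β : Pt d → Pt d}

/-- The vector `G b` with the entries `∑ⱼ bⱼ Gᵢⱼ`. -/
def contract (b : Pt d) : EuclideanSpace ℂ (Fin d × Fin d) →ₗ[ℂ] EuclideanSpace ℂ (Fin d) where
  toFun G := WithLp.toLp 2 fun i => ∑ j, (b j : ℂ) * G (i, j)
  map_add' G G' := by
    ext i
    simp [mul_add, Finset.sum_add_distrib]
  map_smul' c G := by
    ext i
    simp [Finset.mul_sum, mul_left_comm]

theorem norm_contract_le (b : Pt d) (G : EuclideanSpace ℂ (Fin d × Fin d)) :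
    ‖contract b G‖ ≤ ‖b‖ * ‖G‖ := by
  rw [← sq_le_sq₀ (norm_nonneg _) (by positivity), mul_pow, EuclideanSpace.norm_sq_eq,
    EuclideanSpace.norm_sq_eq b, EuclideanSpace.norm_sq_eq G, Fintype.sum_prod_type,
    Finset.mul_sum]
  refine Finset.sum_le_sum fun i _ => ?_
  calc ‖∑ j, (b j : ℂ) * G (i, j)‖ ^ 2 ≤ (∑ j, ‖b j‖ * ‖G (i, j)‖) ^ 2 := by
        gcongr
        refine (norm_sum_le _ _).trans_eq (Finset.sum_congr rfl fun j _ => ?_)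
        rw [norm_mul, Complex.norm_real]
    _ ≤ _ := Finset.sum_mul_sq_le_sq_mul_sq _ _ _

theorem ae_norm_le_supNorm (hβ : MemLp β ∞ (volume.restrict Ω)) :
    ∀ᵐ x ∂(volume.restrict Ω), ‖β x‖ ≤ supNorm Ω β := by
  have h := ae_le_eLpNormEssSup (f := β) (μ := volume.restrict Ω)
  have hne : eLpNorm β ∞ (volume.restrict Ω) ≠ ⊤ := hβ.eLpNorm_ne_top
  filter_upwards [h] with x hx
  rw [← eLpNorm_exponent_top] at hx
  have := ENNReal.toReal_mono hne hx
  simpa [supNorm] using this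

theorem exists_convect (hβ : MemLp β ∞ (volume.restrict Ω)) :
    ∃ T : L2Mat Ω →L[ℂ] L2Vec Ω,
      (∀ G, ∀ᵐ x ∂(volume.restrict Ω), T G x = contract (β x) (G x)) ∧
        ∀ G, ‖T G‖ ≤ supNorm Ω β * ‖G‖ := by
  refine exists_pointwise_operator (fun x => contract (β x))
    (fun f hf => ?_) ?_
  · have hc : Continuous fun p : Pt d × EuclideanSpace ℂ (Fin d × Fin d) => contract p.1 p.2 := by
      simp only [contract, LinearMap.coe_mk, AddHom.coe_mk]
      fun_prop
    have h2 : AEStronglyMeasurable (fun x => (β x, f x)) (volume.restrict Ω) :=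
      hβ.aestronglyMeasurable.prodMk hf
    exact Continuous.comp_aestronglyMeasurable (f := fun x => (β x, f x)) hc h2
  · filter_upwards [ae_norm_le_supNorm hβ] with x hx G
    exact (norm_contract_le _ _).trans (by gcongr)

/-- The operator `∇u ↦ (β·∇)u` on `L²`. -/
def convect (hβ : MemLp β ∞ (volume.restrict Ω)) : L2Mat Ω →L[ℂ] L2Vec Ω :=
  (exists_convect hβ).choose

theorem coeFn_convect (hβ : MemLp β ∞ (volume.restrict Ω)) (G : L2Mat Ω) :
    ∀ᵐ x ∂(volume.restrict Ω), ∀ i, convect hβ G x i = ∑ j, (β x j : ℂ) * G x (i, j) := by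
  filter_upwards [(exists_convect hβ).choose_spec.1 G] with x hx i
  exact congrArg (fun w : EuclideanSpace ℂ (Fin d) => w i) hx

theorem norm_convect_le (hβ : MemLp β ∞ (volume.restrict Ω)) (G : L2Mat Ω) :
    ‖convect hβ G‖ ≤ supNorm Ω β * ‖G‖ :=
  (exists_convect hβ).choose_spec.2 G

/-- For a divergence free field the convective term is skew: its real part on `(u, u)` is
`½ ∫ β·∇|u|² = 0`. -/
theorem re_inner_convect (hβ : IsConvectiveField Ω β) (v : H10 Ω) :
    (inner ℂ (v : FieldPair Ω).fst (convect hβ.1 (v : FieldPair Ω).snd)).re = 0 := by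
  refine H10_induction (p := fun z => (inner ℂ z.fst (convect hβ.1 z.snd)).re = 0) ?_ ?_ v
  · have h1 : Continuous fun z : FieldPair Ω => z.fst := (WithLp.fstL 2 ℂ _ _).continuous
    have h2 : Continuous fun z : FieldPair Ω => z.snd := (WithLp.sndL 2 ℂ _ _).continuous
    exact isClosed_eq (Complex.continuous_re.comp
      (h1.inner ((convect hβ.1).continuous.comp h2))) continuous_const
  · rintro z ⟨u, hu, h1, h2⟩
    obtain ⟨D, hD, hdiv⟩ := hβ.2
    have hsq : ∀ i, IsTestFunction Ω fun x => ‖u i x‖ ^ 2 := fun i => by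
      refine ⟨(hu i).smooth.norm_sq ℝ,
        (hu i).compact.comp_left (g := fun y => ‖y‖ ^ 2) (by simp), ?_⟩
      exact (closure_mono fun x hx => by simpa using hx).trans (hu i).support
    have hbd : ∀ {f g : Pt d → ℝ}, MemLp f ∞ (volume.restrict Ω) → Continuous g →
        HasCompactSupport g → Integrable (fun x => f x * g x) (volume.restrict Ω) :=
      fun {f g} hf hg hgc => by
        have hgi : Integrable g (volume.restrict Ω) :=
          (hg.integrable_of_hasCompactSupport hgc).integrableOn
        have := MemLp.mul (p := ∞) (q := 1) (r := 1) (memLp_one_iff_integrable.2 hgi) hf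
        exact memLp_one_iff_integrable.1 this
    have hβj : ∀ j, MemLp (fun x => β x j) ∞ (volume.restrict Ω) := fun j => hβ.1.eval_piLp j
    have hβi : ∀ i j, Integrable (fun x => β x j * pderiv j (fun x => ‖u i x‖ ^ 2) x)
        (volume.restrict Ω) := fun i j =>
      hbd (hβj j) ((hsq i).continuous_pderiv j) ((hsq i).hasCompactSupport_pderiv j)
    have hDi : ∀ i j, Integrable (fun x => D j j x * ‖u i x‖ ^ 2) (volume.restrict Ω) := fun i j =>
      hbd (hD j j).1 (hsq i).smooth.continuous (hsq i).compact
    have hzero : ∀ i, ∫ x in Ω, ∑ j, β x j * pderiv j (fun x => ‖u i x‖ ^ 2) x = 0 := fun i => by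
      rw [integral_finsetSum _ fun j _ => hβi i j]
      simp_rw [fun j => (hD j j).2 _ (hsq i)]
      rw [Finset.sum_neg_distrib, ← integral_finsetSum _ fun j _ => hDi i j, neg_eq_zero]
      refine integral_eq_zero_of_ae ?_
      filter_upwards [hdiv] with x hx
      rw [← Finset.sum_mul, hx, zero_mul, Pi.zero_apply]
    rw [L2.inner_def]
    have hint : Integrable (fun x => inner ℂ (z.fst x) (convect hβ.1 z.snd x))
      (volume.restrict Ω) := L2.integrable_inner _ _
    have hre : (∫ x in Ω, inner ℂ (z.fst x) (convect hβ.1 z.snd x) : ℂ).re =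
        ∫ x in Ω, (inner ℂ (z.fst x) (convect hβ.1 z.snd x)).re := (integral_re hint).symm
    rw [hre]
    have hpt : ∀ᵐ x ∂(volume.restrict Ω), (inner ℂ (z.fst x) (convect hβ.1 z.snd x)).re =
        ∑ i, (1 / 2) * ∑ j, β x j * pderiv j (fun x => ‖u i x‖ ^ 2) x := by
      filter_upwards [h1, h2, coeFn_convect hβ.1 z.snd] with x e1 e2 e3
      rw [PiLp.inner_apply, Complex.re_sum]
      refine Finset.sum_congr rfl fun i _ => ?_
      rw [e1, e3, RCLike.inner_apply, Finset.sum_mul, Complex.re_sum, Finset.mul_sum]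
      refine Finset.sum_congr rfl fun j _ => ?_
      rw [e2, pderiv_norm_sq (hu i), Complex.inner, mul_assoc, Complex.re_ofReal_mul]
      simp
      ring
    rw [integral_congr_ae hpt, integral_finsetSum]
    · exact Finset.sum_eq_zero fun i _ => by rw [integral_const_mul, hzero, mul_zero]
    · exact fun i _ => (integrable_finsetSum _ fun j _ => hβi i j).const_mul _

end Convection

section Forms

variable {d : ℕ} {Ω : Set (Pt d)} {β : Pt d → Pt d}

/-- The inclusion `u ↦ u` of `H¹₀` into `L²`. -/
def valOp (Ω : Set (Pt d)) : H10 Ω →L[ℂ] L2Vec Ω :=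
  WithLp.fstL 2 ℂ (L2Vec Ω) (L2Mat Ω) ∘L (H10 Ω).subtypeL

/-- The gradient `u ↦ ∇u` from `H¹₀` to `L²`. -/
def gradOp (Ω : Set (Pt d)) : H10 Ω →L[ℂ] L2Mat Ω :=
  WithLp.sndL 2 ℂ (L2Vec Ω) (L2Mat Ω) ∘L (H10 Ω).subtypeL

/-- The two sesquilinear forms have the same integrands. -/
theorem AHat_eq_A (ν : ℝ) (β : Pt d → Pt d) : AHat (Ω := Ω) ν β = A ν β := by
  funext y z
  have h : aHat ν β y.fst z.fst = a ν β y.fst z.fst := by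
    unfold aHat a
    congr 1
    refine integral_congr_ae (Filter.Eventually.of_forall fun x => ?_)
    refine Finset.sum_congr rfl fun i _ => ?_
    rw [Finset.sum_mul]
    refine Finset.sum_congr rfl fun j _ => ?_
    rw [map_mul, Complex.conj_ofReal]
    ring
  rw [AHat, A, h]
  ring

theorem b_eq_inner [IsFiniteMeasure (volume.restrict Ω)] (v : H10 Ω) (q : L20 Ω) : b v q = -inner ℂ (divOp Ω v) q := by
  rw [b, Submodule.coe_inner, L2.inner_def]
  congr 1
  refine integral_congr_ae ?_
  filter_upwards [coeFn_divOp v] with x hx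
  simp [hx]

variable [CompleteSpace (H10 Ω)]

/-- The operator on `H¹₀(Ω, ℂ)ᵈ` that represents the form `a`. -/
def aOp (ν : ℝ) (hβ : MemLp β ∞ (volume.restrict Ω)) : H10 Ω →L[ℂ] H10 Ω :=
  formOp ν (valOp Ω) (gradOp Ω) (convect hβ)

theorem inner_aOp (ν : ℝ) (hβ : MemLp β ∞ (volume.restrict Ω)) (u v : H10 Ω) :
    inner ℂ v (aOp ν hβ u) = (ν : ℂ) * inner ℂ (v : FieldPair Ω).snd (u : FieldPair Ω).snd +
      inner ℂ (v : FieldPair Ω).fst (convect hβ (u : FieldPair Ω).snd) :=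
  inner_formOp (ν : ℂ) (valOp Ω) (gradOp Ω) (convect hβ) u v

theorem a_eq_inner (ν : ℝ) (hβ : MemLp β ∞ (volume.restrict Ω)) (u v : H10 Ω) :
    a ν β u v = inner ℂ v (aOp ν hβ u) := by
  rw [inner_aOp, a, L2.inner_def, L2.inner_def, ← integral_const_mul]
  congr 1
  · refine integral_congr_ae (Filter.Eventually.of_forall fun x => ?_)
    simp [PiLp.inner_apply, Fintype.sum_prod_type, grad]
  · refine integral_congr_ae ?_
    filter_upwards [coeFn_convect hβ (u : FieldPair Ω).snd] with x hx
    simp [PiLp.inner_apply, hx, grad, val]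

theorem re_inner_aOp (ν : ℝ) (hβ : IsConvectiveField Ω β) (u : H10 Ω) :
    (inner ℂ u (aOp ν hβ.1 u)).re = ν * gradNorm u ^ 2 := by
  rw [inner_aOp, Complex.add_re, re_inner_convect hβ, add_zero, Complex.re_ofReal_mul,
    inner_self_eq_norm_sq_to_K]
  congr 1
  norm_cast

theorem norm_inner_aOp_le {ν : ℝ} (hν : 0 ≤ ν) (hβ : MemLp β ∞ (volume.restrict Ω))
    (u v : H10 Ω) :
    ‖inner ℂ v (aOp ν hβ u)‖ ≤ (ν + supNorm Ω β) * gradNorm u * ‖v‖ := by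
  have hfst : ‖(v : FieldPair Ω).fst‖ ≤ ‖v‖ := by
    rw [← sq_le_sq₀ (norm_nonneg _) (norm_nonneg _), norm_sq_H10]
    linarith [sq_nonneg (gradNorm v)]
  have hsnd : ‖(v : FieldPair Ω).snd‖ ≤ ‖v‖ := by
    rw [← sq_le_sq₀ (norm_nonneg _) (norm_nonneg _), norm_sq_H10]
    exact le_add_of_nonneg_left (sq_nonneg _)
  rw [inner_aOp]
  calc _ ≤ ν * (‖v‖ * gradNorm u) + ‖v‖ * (supNorm Ω β * gradNorm u) := by
        refine (norm_add_le _ _).trans (add_le_add ?_ ?_)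
        · rw [norm_mul, Complex.norm_real, Real.norm_of_nonneg hν]
          gcongr
          exact (norm_inner_le_norm _ _).trans (by rw [gradNorm]; gcongr)
        · refine (norm_inner_le_norm _ _).trans ?_
          gcongr
          exact norm_convect_le hβ _
    _ = _ := by ring

variable [CompleteSpace (L20 Ω)] [IsFiniteMeasure (volume.restrict Ω)]

theorem A_eq_inner (ν : ℝ) (hβ : MemLp β ∞ (volume.restrict Ω)) (y z : X Ω) :
    A ν β y z = inner ℂ z (saddleOp (aOp ν hβ) (divOp Ω) y) := by
  have h1 := a_eq_inner ν hβ y.fst z.fst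
  have h2 := b_eq_inner z.fst y.snd
  have h3 : conj (b y.fst z.snd) = -inner ℂ z.snd (divOp Ω y.fst) := by
    rw [b_eq_inner, map_neg]
    exact congrArg Neg.neg (inner_conj_symm z.snd (divOp Ω y.fst))
  have h4 : A ν β y z = a ν β y.fst z.fst + b z.fst y.snd - conj (b y.fst z.snd) := rfl
  have h5 : ∀ p q r : ℂ, p + -q - -r = p - q + r := fun p q r => by ring
  rw [h1, h2, h3, h5] at h4
  exact h4.trans (inner_saddleOp (aOp ν hβ) (divOp Ω) y z).symm

end Forms

/-! ### Inf-sup values and stability -/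

section Stability

variable {X' : Type*} [NormedAddCommGroup X'] [InnerProductSpace ℂ X']

/-- The test function is `T y`, scaled to the norm `√2 / γ`. -/
theorem exists_stable_test {T S : X' →L[ℂ] X'} (hST : ∀ x, S (T x) = x) (y : X') :
    ∃ z : X', ‖z‖ ≤ √2 * ‖S‖ ∧ (inner ℂ z (T y)).im = 0 ∧ √2 * ‖y‖ ≤ (inner ℂ z (T y)).re := by
  by_cases hT : T y = 0
  · have hy : y = 0 := by rw [← hST y, hT, map_zero]
    exact ⟨0, by simp, by simp, by simp [hy]⟩
  · have hT' : ‖T y‖ ≠ 0 := norm_ne_zero_iff.2 hT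
    set s : ℝ := √2 * ‖S‖ / ‖T y‖ with hs
    have hs0 : 0 ≤ s := by positivity
    have e : inner ℂ ((s : ℂ) • T y) (T y) = ((s * ‖T y‖ ^ 2 : ℝ) : ℂ) := by
      rw [inner_smul_left, inner_self_eq_norm_sq_to_K, Complex.conj_ofReal,
        Complex.ofReal_mul, Complex.ofReal_pow]
      rfl
    refine ⟨(s : ℂ) • T y, ?_, ?_, ?_⟩
    · rw [norm_smul, Complex.norm_real, Real.norm_of_nonneg hs0, hs, div_mul_cancel₀ _ hT']
    · rw [e, Complex.ofReal_im]
    · rw [e, Complex.ofReal_re]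
      have h1 := S.le_opNorm (T y)
      rw [hST] at h1
      calc √2 * ‖y‖ ≤ √2 * (‖S‖ * ‖T y‖) := by gcongr
        _ = s * ‖T y‖ ^ 2 := by rw [hs]; field_simp

variable [CompleteSpace X']

/-- The two inf-sup values of the form `⟪z, T y⟫` of an invertible operator agree, because `T` and
its adjoint have inverses of the same norm. -/
theorem inf_sup_inner [Nontrivial X'] {T S : X' →L[ℂ] X'} (hTS : ∀ x, T (S x) = x)
    (hST : ∀ x, S (T x) = x) :
    (⨅ y : {y : X' // y ≠ 0}, ⨆ z : {z : X' // z ≠ 0},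
      ENNReal.ofReal (‖inner ℂ z.1 (T y.1)‖ / (‖y.1‖ * ‖z.1‖))) = ENNReal.ofReal (1 / ‖S‖) ∧
    (⨅ z : {z : X' // z ≠ 0}, ⨆ y : {y : X' // y ≠ 0},
      ENNReal.ofReal (‖inner ℂ z.1 (T y.1)‖ / (‖y.1‖ * ‖z.1‖))) = ENNReal.ofReal (1 / ‖S‖) := by
  constructor
  · rw [← iInf_norm_div_eq hTS hST]
    exact iInf_congr fun y => iSup_norm_inner_div (T y.1) (norm_pos_iff.2 y.2)
  · have hTS' : ∀ x, T.adjoint (S.adjoint x) = x := fun x => ext_inner_right ℂ fun w => by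
      rw [ContinuousLinearMap.adjoint_inner_left, ContinuousLinearMap.adjoint_inner_left, hST]
    have hST' : ∀ x, S.adjoint (T.adjoint x) = x := fun x => ext_inner_right ℂ fun w => by
      rw [ContinuousLinearMap.adjoint_inner_left, ContinuousLinearMap.adjoint_inner_left, hTS]
    have hn : ‖S.adjoint‖ = ‖S‖ := LinearIsometryEquiv.norm_map _ _
    rw [← hn, ← iInf_norm_div_eq hTS' hST']
    refine iInf_congr fun z => ?_
    rw [← iSup_norm_inner_div (T.adjoint z.1) (norm_pos_iff.2 z.2)]
    refine iSup_congr fun y => ?_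
    rw [ContinuousLinearMap.adjoint_inner_right, ← norm_inner_symm, mul_comm]

theorem norm_fst_add_norm_snd_le {H Q : Type*} [NormedAddCommGroup H] [NormedAddCommGroup Q]
    (y : WithLp 2 (H × Q)) : ‖y.fst‖ + ‖y.snd‖ ≤ √2 * ‖y‖ := by
  refine le_of_sq_le_sq ?_ (by positivity)
  rw [mul_pow, Real.sq_sqrt zero_le_two, WithLp.prod_norm_sq_eq_of_L2]
  exact add_sq_le

end Stability

section SaddleInfSup

/-- The quantity `γ⁻²` is at most this constant, by the a priori estimate. -/
def stabConst (ν B Cp C : ℝ) : ℝ :=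
  2 / (ν ^ 2 * Cp ^ 2) + 4 * C ^ 2 + 8 * C ^ 4 * ((ν + B) ^ 2 / ν) ^ 2

theorem stabConst_pos {ν B Cp C : ℝ} (hν : 0 < ν) (hCp : 0 < Cp) : 0 < stabConst ν B Cp C := by
  unfold stabConst
  positivity

variable {H Q : Type*} [NormedAddCommGroup H] [InnerProductSpace ℂ H] [CompleteSpace H]
  [NormedAddCommGroup Q] [InnerProductSpace ℂ Q] [CompleteSpace Q]
  {𝒜 : H →L[ℂ] H} {D : H →L[ℂ] Q} {g : H → ℝ} {ν B : ℝ}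

/-- The inf-sup values and the stability of the form of a saddle point problem. The predicates
`P` and `R` describe the admissible constants of coercivity and of the right inverse of `D`. -/
theorem exists_infSup_saddleOp [Nontrivial H] {F : WithLp 2 (H × Q) → WithLp 2 (H × Q) → ℂ}
    (hF : ∀ y z, F y z = inner ℂ z (saddleOp 𝒜 D y)) (hν : 0 < ν) (hB : 0 ≤ B)
    (hg : ∀ u, 0 ≤ g u) (h1 : ∀ u, (inner ℂ u (𝒜 u)).re = ν * g u ^ 2)
    (h3 : ∀ u v, ‖inner ℂ v (𝒜 u)‖ ≤ (ν + B) * g u * ‖v‖) {P R : ℝ → Prop}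
    (hP : ∀ Cp, P Cp → 0 < Cp ∧ ∀ u, Cp * ‖u‖ ^ 2 ≤ g u ^ 2)
    (hR : ∀ C, R C → 0 < C ∧ ∀ q, ∃ v, ‖v‖ ≤ C * ‖q‖ ∧ D v = -q)
    (hP₀ : ∃ Cp, P Cp) (hR₀ : ∃ C, R C) :
    ∃ γ : ℝ, 0 < γ ∧
      (⨅ z : {z : WithLp 2 (H × Q) // z ≠ 0}, ⨆ y : {y : WithLp 2 (H × Q) // y ≠ 0},
        ENNReal.ofReal (‖F y.1 z.1‖ / (‖y.1‖ * ‖z.1‖))) = ENNReal.ofReal γ ∧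
      (⨅ y : {y : WithLp 2 (H × Q) // y ≠ 0}, ⨆ z : {z : WithLp 2 (H × Q) // z ≠ 0},
        ENNReal.ofReal (‖F y.1 z.1‖ / (‖y.1‖ * ‖z.1‖))) = ENNReal.ofReal γ ∧
      (∀ y : WithLp 2 (H × Q), ∃ z : WithLp 2 (H × Q), ‖z.fst‖ + ‖z.snd‖ ≤ 2 / γ ∧
        (F y z).im = 0 ∧ ‖y.fst‖ + ‖y.snd‖ ≤ (F y z).re) ∧
      ∀ Cp C, P Cp → R C → 1 / √(stabConst ν B Cp C) ≤ γ := by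
  obtain rfl : F = fun y z => inner ℂ z (saddleOp 𝒜 D y) :=
    funext fun y => funext fun z => hF y z
  have : Nontrivial (WithLp 2 (H × Q)) := by
    obtain ⟨v, hv⟩ := exists_ne (0 : H)
    exact ⟨WithLp.toLp 2 (v, 0), 0, fun h => hv (congrArg WithLp.fst h)⟩
  set T := saddleOp 𝒜 D
  have hbound : ∀ Cp C, P Cp → R C → ∀ y, ‖y‖ ≤ √(stabConst ν B Cp C) * ‖T y‖ := by
    intro Cp C hCp hC y
    refine le_of_sq_le_sq ?_ (by positivity)
    rw [mul_pow, Real.sq_sqrt (stabConst_pos hν (hP Cp hCp).1).le]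
    exact norm_sq_le_saddleOp hν hB (hP Cp hCp).1 (hR C hC).1 hg h1 (hP Cp hCp).2 h3 (hR C hC).2 y
  obtain ⟨Cp₀, hCp₀⟩ := hP₀
  obtain ⟨C₀, hC₀⟩ := hR₀
  obtain ⟨S, hTS, hST, -⟩ := exists_inverse_of_le_norm
    (Real.sqrt_pos.2 (stabConst_pos hν (hP Cp₀ hCp₀).1)) (hbound Cp₀ C₀ hCp₀ hC₀)
    (eq_zero_of_inner_saddleOp_eq_zero hν (hP Cp₀ hCp₀).1 h1 (hP Cp₀ hCp₀).2
      fun q => ((hR C₀ hC₀).2 q).imp fun v hv => hv.2)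
  have hS : 0 < ‖S‖ := by
    obtain ⟨x₀, hx₀⟩ := exists_ne (0 : WithLp 2 (H × Q))
    exact norm_pos_iff.2 fun h => hx₀ (by rw [← hTS x₀, h]; simp)
  obtain ⟨hl, hr⟩ := inf_sup_inner hTS hST
  refine ⟨1 / ‖S‖, by positivity, hr, hl, fun y => ?_, fun Cp C hCp hC => ?_⟩
  · obtain ⟨z, hz, him, hre⟩ := exists_stable_test hST y
    refine ⟨z, ?_, him, (norm_fst_add_norm_snd_le y).trans hre⟩
    calc _ ≤ √2 * ‖z‖ := norm_fst_add_norm_snd_le z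
      _ ≤ √2 * (√2 * ‖S‖) := by gcongr
      _ = 2 / (1 / ‖S‖) := by
        rw [← mul_assoc, Real.mul_self_sqrt zero_le_two]
        simp
  · refine one_div_le_one_div_of_le hS (S.opNorm_le_bound (Real.sqrt_nonneg _) fun x => ?_)
    have := hbound Cp C hCp hC (S x)
    rwa [hTS] at this

end SaddleInfSup

section Main

variable {d : ℕ} {Ω : Set (Pt d)}

theorem nontrivial_H10 (hd : 0 < d) (hΩ : IsOpen Ω) (hne : Ω.Nonempty) : Nontrivial (H10 Ω) := by
  obtain ⟨x₀, hx₀⟩ := hne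
  obtain ⟨r, hr, hball⟩ := Metric.isOpen_iff.1 hΩ x₀ hx₀
  obtain ⟨η₀, hη₀, hη₀1⟩ := exists_bump x₀ (half_pos hr)
  have hη := hη₀.mono ((Metric.closedBall_subset_ball (half_lt_self hr)).trans hball)
  obtain ⟨z, hz, h1, -⟩ := exists_mem_testFields (u := fun _ => η₀) fun _ => hη
  refine ⟨⟨z, testFields_le_H10 hz⟩, 0, fun h => ?_⟩
  have hz0 : z = 0 := congrArg Subtype.val h
  have h2 : ∀ᵐ x ∂(volume.restrict Ω), η₀ x = 0 := by
    filter_upwards [h1, Lp.coeFn_zero (EuclideanSpace ℂ (Fin d)) 2 (volume.restrict Ω)]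
      with x e1 e2
    rw [hz0, WithLp.zero_fst] at e1
    rw [← e1 ⟨0, hd⟩, e2]
    rfl
  have h3 : ∫ x in Ω, η₀ x = 0 := integral_eq_zero_of_ae h2
  rw [hη.setIntegral, hη₀1] at h3
  exact one_ne_zero h3

theorem IsPoincareConst.le_one [Nontrivial (H10 Ω)] {Cp : ℝ} (h : IsPoincareConst Ω Cp) :
    Cp ≤ 1 := by
  obtain ⟨v, hv⟩ := exists_ne (0 : H10 Ω)
  have hv' : 0 < ‖v‖ ^ 2 := by
    have := norm_pos_iff.2 hv
    positivity
  have h1 := h.2 v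
  have h2 := norm_sq_H10 v
  by_contra! hlt
  nlinarith [sq_nonneg ‖(v : FieldPair Ω).fst‖]

theorem supNorm_nonneg (β : Pt d → Pt d) : 0 ≤ supNorm Ω β := ENNReal.toReal_nonneg

theorem exists_infSup (hd : 0 < d) (hΩ : IsLipschitzPolyhedralDomain Ω) {ν : ℝ} (hν : 0 < ν)
    {β : Pt d → Pt d} (hβ : IsConvectiveField Ω β) :
    ∃ γ : ℝ, 0 < γ ∧ infSupRight (A (Ω := Ω) ν β) = ENNReal.ofReal γ ∧
      infSupLeft (A (Ω := Ω) ν β) = ENNReal.ofReal γ ∧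
      IsStableWith (A (Ω := Ω) ν β) (2 / γ) ∧
      ∀ Cp C, IsPoincareConst Ω Cp → IsDivConst Ω C →
        1 / √(stabConst ν (supNorm Ω β) Cp C) ≤ γ := by
  have : IsFiniteMeasure (volume.restrict Ω) := ⟨by simpa using hΩ.isBounded.measure_lt_top⟩
  have : CompleteSpace (H10 Ω) := (Submodule.isClosed_topologicalClosure _).completeSpace_coe
  have : CompleteSpace (L20 Ω) := isClosed_L20.completeSpace_coe
  have : Nontrivial (H10 Ω) := nontrivial_H10 hd hΩ.isOpen hΩ.isConnected.nonempty
  have hsolve : ∀ C, IsDivConst Ω C →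
      0 < C ∧ ∀ q : L20 Ω, ∃ v, ‖v‖ ≤ C * ‖q‖ ∧ divOp Ω v = -q := by
    refine fun C hC => ⟨hC.1, fun q => ?_⟩
    obtain ⟨v, hv, hdiv⟩ := hC.2 q
    refine ⟨v, hv, Subtype.ext (Lp.ext ?_)⟩
    filter_upwards [coeFn_divOp v, hdiv, Lp.coeFn_neg (q : Lp ℂ 2 (volume.restrict Ω))]
      with x h1 h2 h3
    rw [h1, h2, Submodule.coe_neg, h3, Pi.neg_apply]
  exact exists_infSup_saddleOp (A_eq_inner ν hβ.1) hν (supNorm_nonneg (Ω := Ω) β)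
    (fun u => norm_nonneg _) (re_inner_aOp ν hβ) (norm_inner_aOp_le hν.le hβ.1)
    (fun Cp hCp => hCp) hsolve (exists_isPoincareConst hd hΩ.isBounded) (exists_isDivConst hd hΩ)

end Main

section Constants

variable {ν B Cp C : ℝ}

/-- The explicit bound only weakens the a priori estimate, as `Cp ≤ 1`. -/
theorem stabConst_le_explicit (hν : 0 < ν) (hCp : 0 < Cp) (hCp1 : Cp ≤ 1) :
    stabConst ν B Cp C ≤ 2 * (1 / (ν ^ 2 * Cp ^ 2) + 2 * C ^ 2 *
      (1 + 2 * C ^ 2 / Cp ^ 2 * (√ν + B / √ν) ^ 4)) := by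
  have hs : 0 < √ν := Real.sqrt_pos.2 hν
  have e : (√ν + B / √ν) ^ 4 = ((ν + B) ^ 2 / ν) ^ 2 := by
    have h1 : √ν + B / √ν = (ν + B) / √ν := by
      rw [add_div, Real.div_sqrt]
    have h2 : √ν ^ 4 = ν ^ 2 := by
      rw [show 4 = 2 * 2 from rfl, pow_mul, Real.sq_sqrt hν.le]
    rw [h1, div_pow, h2, div_pow, ← pow_mul]
  have h3 : 8 * C ^ 4 * ((ν + B) ^ 2 / ν) ^ 2 ≤ 8 * C ^ 4 * ((ν + B) ^ 2 / ν) ^ 2 / Cp ^ 2 := by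
    rw [le_div_iff₀ (by positivity)]
    refine mul_le_of_le_one_right (by positivity) ?_
    exact pow_le_one₀ hCp.le hCp1
  rw [e, stabConst]
  have e2 : 2 * (1 / (ν ^ 2 * Cp ^ 2) + 2 * C ^ 2 *
      (1 + 2 * C ^ 2 / Cp ^ 2 * ((ν + B) ^ 2 / ν) ^ 2)) = 2 / (ν ^ 2 * Cp ^ 2) + 4 * C ^ 2 +
      8 * C ^ 4 * ((ν + B) ^ 2 / ν) ^ 2 / Cp ^ 2 := by ring
  rw [e2]
  linarith

/-- For `ν < ν⁺` the power of `(ν + B)² / ν = ν (1 + B / ν)²` is controlled by that of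
`ν + B / ν`. -/
theorem stabConst_le_generic {νmax : ℝ} (hν : 0 < ν) (hνmax : ν < νmax) (hB : 0 ≤ B)
    (hCp : 0 < Cp) :
    stabConst ν B Cp C ≤ 2 ^ 2 * (1 / (ν ^ 2 * Cp ^ 2) +
      2 * (C ^ 2 + 8 * C ^ 4 * νmax ^ 2 * (1 + 1 / Cp ^ 2)) *
        (1 + Cp ^ 2 * (ν + B / ν) ^ 4)) := by
  set w := (ν + B / ν) ^ 4 with hw
  have hBν : 0 ≤ B / ν := by positivity
  have hw0 : 0 ≤ w := by positivity
  have h1 : ((ν + B) ^ 2 / ν) ^ 2 = ν ^ 2 * (1 + B / ν) ^ 4 := by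
    field_simp
  have h2 : (1 + B / ν) ^ 4 ≤ 8 * (1 + (B / ν) ^ 4) := by
    have := add_pow_le zero_le_one hBν 4
    norm_num at this
    linarith
  have h3 : (B / ν) ^ 4 ≤ w := by
    rw [hw]
    gcongr
    linarith
  have h4 : ((ν + B) ^ 2 / ν) ^ 2 ≤ νmax ^ 2 * (8 * (1 + w)) := by
    rw [h1]
    gcongr
    linarith
  have h5 : 8 * C ^ 4 * ((ν + B) ^ 2 / ν) ^ 2 ≤ 8 * C ^ 4 * (νmax ^ 2 * (8 * (1 + w))) := by
    gcongr
  have e : 2 ^ 2 * (1 / (ν ^ 2 * Cp ^ 2) +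
      2 * (C ^ 2 + 8 * C ^ 4 * νmax ^ 2 * (1 + 1 / Cp ^ 2)) * (1 + Cp ^ 2 * w)) =
      4 / (ν ^ 2 * Cp ^ 2) + 8 * C ^ 2 * (1 + Cp ^ 2 * w) +
        64 * C ^ 4 * νmax ^ 2 * (1 + Cp ^ 2 * w + 1 / Cp ^ 2 + w) := by
    field_simp
    ring
  rw [e, stabConst]
  have h6 : 2 / (ν ^ 2 * Cp ^ 2) ≤ 4 / (ν ^ 2 * Cp ^ 2) := by gcongr; norm_num
  have h7 : 4 * C ^ 2 ≤ 8 * C ^ 2 * (1 + Cp ^ 2 * w) := by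
    have : 0 ≤ C ^ 2 * (Cp ^ 2 * w) := by positivity
    nlinarith [sq_nonneg C]
  have h8 : 8 * C ^ 4 * (νmax ^ 2 * (8 * (1 + w))) ≤
      64 * C ^ 4 * νmax ^ 2 * (1 + Cp ^ 2 * w + 1 / Cp ^ 2 + w) := by
    have : 0 ≤ 64 * C ^ 4 * νmax ^ 2 * (Cp ^ 2 * w + 1 / Cp ^ 2) := by positivity
    linarith
  linarith

theorem stabConst_le_uniform {νmin νmax M : ℝ} (hνmin : 0 < νmin) (h1 : νmin < ν) (h2 : ν < νmax)
    (hB : 0 ≤ B) (hM : B ≤ M) (hCp : 0 < Cp) :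
    stabConst ν B Cp C ≤ 2 / (νmin ^ 2 * Cp ^ 2) + 4 * C ^ 2 +
      8 * C ^ 4 * ((νmax + M) ^ 2 / νmin) ^ 2 := by
  have hν : 0 < ν := hνmin.trans h1
  unfold stabConst
  gcongr

end Constants

end Oseen

end

theorem mainTheorem8 (d : ℕ) (hd : d = 2 ∨ d = 3) (Ω : Set (Oseen.Pt d))
    (hΩ : Oseen.IsLipschitzPolyhedralDomain Ω) :
    (∃ Cp : ℝ, Oseen.IsPoincareConst Ω Cp) ∧ (∃ C : ℝ, Oseen.IsDivConst Ω C) ∧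
    ∃ γ : ℝ → (Oseen.Pt d → Oseen.Pt d) → ℝ,
      -- the inf-sup conditions and the resulting stability, for both forms
      (∀ (ν : ℝ) (β : Oseen.Pt d → Oseen.Pt d), 0 < ν → Oseen.IsConvectiveField Ω β →
        0 < γ ν β ∧
        Oseen.infSupRight (Oseen.A (Ω := Ω) ν β) = ENNReal.ofReal (γ ν β) ∧
        Oseen.infSupLeft (Oseen.A (Ω := Ω) ν β) = ENNReal.ofReal (γ ν β) ∧
        Oseen.IsStableWith (Oseen.A (Ω := Ω) ν β) (2 / γ ν β) ∧
        Oseen.infSupRight (Oseen.AHat (Ω := Ω) ν β) = ENNReal.ofReal (γ ν β) ∧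
        Oseen.infSupLeft (Oseen.AHat (Ω := Ω) ν β) = ENNReal.ofReal (γ ν β) ∧
        Oseen.IsStableWith (Oseen.AHat (Ω := Ω) ν β) (2 / γ ν β)) ∧
      -- the explicit bound in terms of the constants of the domain
      (∀ Cp C : ℝ, Oseen.IsPoincareConst Ω Cp → Oseen.IsDivConst Ω C →
        ∀ (ν : ℝ) (β : Oseen.Pt d → Oseen.Pt d), 0 < ν → Oseen.IsConvectiveField Ω β →
          1 / √(2 * (1 / (ν ^ 2 * Cp ^ 2) + 2 * C ^ 2 *
            (1 + 2 * C ^ 2 / Cp ^ 2 * (√ν + Oseen.supNorm Ω β / √ν) ^ 4))) ≤ γ ν β) ∧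
      -- the explicit bound with a generic constant, for bounded viscosities
      (∀ Cp νmax : ℝ, Oseen.IsPoincareConst Ω Cp → 0 < νmax → ∃ C : ℝ, 0 < C ∧
        ∀ (ν : ℝ) (β : Oseen.Pt d → Oseen.Pt d), 0 < ν → ν < νmax →
          Oseen.IsConvectiveField Ω β →
          1 / (2 * √(1 / (ν ^ 2 * Cp ^ 2) + 2 * C *
            (1 + Cp ^ 2 * (ν + Oseen.supNorm Ω β / ν) ^ 4))) ≤ γ ν β) ∧
      -- uniformity with respect to the viscosity
      (∀ νmin νmax M : ℝ, 0 < νmin → νmin < νmax → ∃ γ₀ : ℝ, 0 < γ₀ ∧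
        ∀ (ν : ℝ) (β : Oseen.Pt d → Oseen.Pt d), νmin < ν → ν < νmax →
          Oseen.IsConvectiveField Ω β → Oseen.supNorm Ω β ≤ M → γ₀ ≤ γ ν β) := by
  have hd0 : 0 < d := by omega
  have hH : Nontrivial (Oseen.H10 Ω) :=
    Oseen.nontrivial_H10 hd0 hΩ.isOpen hΩ.isConnected.nonempty
  obtain ⟨Cp₀, hCp₀⟩ := Oseen.exists_isPoincareConst hd0 hΩ.isBounded
  obtain ⟨C₀, hC₀⟩ := Oseen.exists_isDivConst hd0 hΩ
  refine ⟨⟨Cp₀, hCp₀⟩, ⟨C₀, hC₀⟩, fun ν β => (Oseen.infSupLeft (Oseen.A (Ω := Ω) ν β)).toReal, ?_⟩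
  have key : ∀ (ν : ℝ) (β : Oseen.Pt d → Oseen.Pt d), 0 < ν → Oseen.IsConvectiveField Ω β →
      0 < (Oseen.infSupLeft (Oseen.A (Ω := Ω) ν β)).toReal ∧
      Oseen.infSupRight (Oseen.A (Ω := Ω) ν β) =
        ENNReal.ofReal (Oseen.infSupLeft (Oseen.A (Ω := Ω) ν β)).toReal ∧
      Oseen.infSupLeft (Oseen.A (Ω := Ω) ν β) =
        ENNReal.ofReal (Oseen.infSupLeft (Oseen.A (Ω := Ω) ν β)).toReal ∧
      Oseen.IsStableWith (Oseen.A (Ω := Ω) ν β)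
        (2 / (Oseen.infSupLeft (Oseen.A (Ω := Ω) ν β)).toReal) ∧
      ∀ Cp C, Oseen.IsPoincareConst Ω Cp → Oseen.IsDivConst Ω C →
        1 / √(Oseen.stabConst ν (Oseen.supNorm Ω β) Cp C) ≤
          (Oseen.infSupLeft (Oseen.A (Ω := Ω) ν β)).toReal := by
    intro ν β hν hβ
    obtain ⟨γ, hγ, hr, hl, hs, hb⟩ := Oseen.exists_infSup hd0 hΩ hν hβ
    have e : (Oseen.infSupLeft (Oseen.A (Ω := Ω) ν β)).toReal = γ := by
      rw [hl, ENNReal.toReal_ofReal hγ.le]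
    rw [e]
    exact ⟨hγ, hr, hl, hs, hb⟩
  have hmono : ∀ {K K' : ℝ}, 0 < K → K ≤ K' → 1 / √K' ≤ 1 / √K := fun hK hKK' =>
    one_div_le_one_div_of_le (Real.sqrt_pos.2 hK) (Real.sqrt_le_sqrt hKK')
  refine ⟨fun ν β hν hβ => ?_, fun Cp C hCp hC ν β hν hβ => ?_, fun Cp νmax hCp hνmax => ?_,
    fun νmin νmax M hνmin hνmax => ?_⟩
  · obtain ⟨hγ, hr, hl, hs, -⟩ := key ν β hν hβ
    rw [Oseen.AHat_eq_A]
    exact ⟨hγ, hr, hl, hs, hr, hl, hs⟩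
  · exact (hmono (Oseen.stabConst_pos hν hCp.1)
      (Oseen.stabConst_le_explicit hν hCp.1 hCp.le_one)).trans ((key ν β hν hβ).2.2.2.2 Cp C hCp hC)
  · have hC0 := hC₀.1
    refine ⟨C₀ ^ 2 + 8 * C₀ ^ 4 * νmax ^ 2 * (1 + 1 / Cp ^ 2), by positivity,
      fun ν β hν hνlt hβ => ?_⟩
    refine le_trans ?_ ((key ν β hν hβ).2.2.2.2 Cp C₀ hCp hC₀)
    have h := hmono (Oseen.stabConst_pos hν hCp.1) (Oseen.stabConst_le_generic (C := C₀) hν hνlt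
      (Oseen.supNorm_nonneg (Ω := Ω) β) hCp.1)
    rwa [Real.sqrt_mul (by positivity), Real.sqrt_sq zero_le_two] at h
  · have hCp0 := hCp₀.1
    refine ⟨1 / √(2 / (νmin ^ 2 * Cp₀ ^ 2) + 4 * C₀ ^ 2 +
      8 * C₀ ^ 4 * ((νmax + M) ^ 2 / νmin) ^ 2), ?_, fun ν β h1 h2 hβ hM => ?_⟩
    · have hpos : 0 < 2 / (νmin ^ 2 * Cp₀ ^ 2) + 4 * C₀ ^ 2 +
        8 * C₀ ^ 4 * ((νmax + M) ^ 2 / νmin) ^ 2 := by positivity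
      exact one_div_pos.2 (Real.sqrt_pos.2 hpos)
    · have hν := hνmin.trans h1
      exact (hmono (Oseen.stabConst_pos hν hCp0) (Oseen.stabConst_le_uniform hνmin h1 h2
        (Oseen.supNorm_nonneg (Ω := Ω) β) hM hCp0)).trans ((key ν β hν hβ).2.2.2.2 Cp₀ C₀ hCp₀ hC₀)
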